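/- Let $\phi=\frac{1+\sqrt5}{2}$. The golden L is the translation surface obtained from the unit square $[0,1]^2$ by attaching the rectangle $[1,\phi]\times[0,1]$ on its right and the rectangle $[0,1]\times[1,\phi]$ on its top, opposite parallel sides being glued by translations. The double pentagon consists of a regular pentagon with a horizontal side and with diagonals of length $1$ and of its image under reflection in its horizontal side, every side being glued by a translation to the opposite parallel side of the other pentagon. The matrix $P=\begin{pmatrix}1&\cos(\pi/5)\\0&\sin(\pi/5)\end{pmatrix}$ takes the golden L to the double pentagon. A trajectory is a bi-infinite straight line on the surface that hits no corner; a periodic trajectory has a holonomy vector, the total displacement when it is traversed exactly once. A cylinder is a maximal family of parallel periodic trajectories. The combinatorial period of a periodic trajectory on the double pentagon is the number of (glued) edges of the pentagons that it crosses when it is traversed exactly once; the cutting sequence of the trajectory is the bi-infinite sequence of the edges it crosses. Let $\Lambda$ be the set of short cylinder vectors of the golden L in $\Sigma=\{(x,y):x>0,\ y\ge0\}$, that is, of the vectors $\mathbf v\in\Sigma$ that are the holonomy vector of a periodic trajectory on the golden L such that no periodic trajectory in the direction $\mathbf v$ is shorter. Theorem (Combinatorial Period Theorem). Every $\mathbf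 u\in\Sigma$ whose direction is that of a periodic trajectory on the golden L is a positive multiple of a vector $\mathbf v=[a+b\phi,\,c+d\phi]\in\Lambda$ with $a,b,c,d\in\mathbf N=\{0,1,2,\dots\}$. For every vector $\mathbf v=[a+b\phi,\,c+d\phi]\in\Lambda$ with $a,b,c,d\in\mathbf N$: (1) the golden L has exactly two cylinders in the direction $\mathbf v$; the trajectories in one of them (the short trajectories) have holonomy vector $\mathbf v$, and those in the other (the long trajectories) have holonomy vector $\phi\mathbf v$; (2) the double pentagon has exactly two cylinders in the corresponding direction $P\mathbf v$; the trajectories in one of them (the short trajectories) have holonomy vector $P\mathbf v$ and combinatorial period $2(a+b+c+d)$, and those in the other (the long trajectories) have holonomy vector $\phi P\mathbf v$ and combinatorial period $2(a+2b+c+2d)$. In both cases the combinatorial period is also the least period of the cutting sequence. -/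

import Mathlib

noncomputable section

namespace PentagonL

/-- Vectors (and points) of the Euclidean plane, in coordinates. -/
abbrev Plane : Type := Fin 2 → ℝ

/-- The signed area spanned by two plane vectors. -/
def cross (u w : Plane) : ℝ := u 0 * w 1 - u 1 * w 0

/-- A translation surface tiled by convex `n`-gons indexed by `ι`. The polygon `i` has the vertices
`vertex i 0, …, vertex i (n - 1)` in counterclockwise order, and its `k`-th side goes from
`vertex i k` to `vertex i (k + 1)`, with indices modulo `n`. Sides are glued in pairs by translations. -/
structure TranslationSurface (ι : Type) (n : ℕ) [NeZero n] where
  vertex : ι → Fin n → Plane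
  glue : ι × Fin n → ι × Fin n
  /-- each polygon is strictly convex and lies to the left of each of its sides -/
  convex : ∀ i k j, j ≠ k → j ≠ k + 1 →
    0 < cross (vertex i (k + 1) - vertex i k) (vertex i j - vertex i k)
  glue_glue : ∀ e, glue (glue e) = e
  /-- glued sides are parallel, of the same length, and oppositely oriented -/
  glue_side : ∀ e, vertex (glue e).1 ((glue e).2 + 1) - vertex (glue e).1 (glue e).2 =
    -(vertex e.1 (e.2 + 1) - vertex e.1 e.2)

namespace TranslationSurface

variable {ι : Type} {n : ℕ} [NeZero n]

/-- The point at the fraction `t` of the side `e`. The gluing identifies `S.point e t` with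
`S.point (S.glue e) (1 - t)`. -/
def point (S : TranslationSurface ι n) (e : ι × Fin n) (t : ℝ) : Plane :=
  S.vertex e.1 e.2 + t • (S.vertex e.1 (e.2 + 1) - S.vertex e.1 e.2)

/-- A bi-infinite linear trajectory in direction `v` on `S` that hits no corner, recorded by its
successive crossings of edges, with an arbitrary crossing taken as number `0`. At crossing number `k`
it leaves a polygon through the interior point `S.point (side k) (pos k)` of the side `side k`, enters
the polygon glued to that side, and traverses the latter along the vector `time k • v` up to
crossing number `k + 1`. -/
@[ext]
structure Trajectory (S : TranslationSurface ι n) (v : Plane) where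
  side : ℤ → ι × Fin n
  pos : ℤ → ℝ
  time : ℤ → ℝ
  pos_mem : ∀ k, pos k ∈ Set.Ioo (0 : ℝ) 1
  time_pos : ∀ k, 0 < time k
  same_polygon : ∀ k, (S.glue (side k)).1 = (side (k + 1)).1
  /-- the trajectory crosses the polygon instead of running along one of its sides -/
  side_ne : ∀ k, S.glue (side k) ≠ side (k + 1)
  segment : ∀ k, S.point (side (k + 1)) (pos (k + 1)) =
    S.point (S.glue (side k)) (1 - pos k) + time k • v

namespace Trajectory

variable {S : TranslationSurface ι n} {v : Plane}

/-- After `N` edge crossings, `N > 0`, the trajectory closes up. -/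
def ClosesAfter (τ : S.Trajectory v) (N : ℕ) : Prop :=
  0 < N ∧ ∀ k : ℤ, τ.side (k + N) = τ.side k ∧ τ.pos (k + N) = τ.pos k

def IsPeriodic (τ : S.Trajectory v) : Prop := ∃ N, τ.ClosesAfter N

/-- The combinatorial period of `τ` is `N`: traversed exactly once, the closed trajectory `τ`
crosses `N` edges. -/
def HasCombinatorialPeriod (τ : S.Trajectory v) (N : ℕ) : Prop :=
  IsLeast {M | τ.ClosesAfter M} N

/-- The holonomy vector of the periodic trajectory `τ` is `h`: the total displacement when `τ` is
traversed exactly once. -/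
def HasHolonomy (τ : S.Trajectory v) (h : Plane) : Prop :=
  ∃ N : ℕ, τ.HasCombinatorialPeriod N ∧ h = (∑ k ∈ Finset.range N, τ.time k) • v

/-- The cutting sequence of `τ`: the bi-infinite sequence of the edges of the surface that it
crosses, an edge being a pair of glued sides. -/
def cuttingSequence (τ : S.Trajectory v) (k : ℤ) : Sym2 (ι × Fin n) :=
  s(τ.side k, S.glue (τ.side k))

/-- `N` is the least period of the cutting sequence of `τ`. -/
def HasCuttingPeriod (τ : S.Trajectory v) (N : ℕ) : Prop :=
  IsLeast {M : ℕ | 0 < M ∧ ∀ k : ℤ, τ.cuttingSequence (k + M) = τ.cuttingSequence k} N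

/-- `τ` can be moved to `τ'` (up to renumbering the crossings of `τ'`) through a continuous family
of periodic trajectories in the same direction. -/
def SameCylinder (τ τ' : S.Trajectory v) : Prop :=
  ∃ F : unitInterval → S.Trajectory v,
    (∀ s, (F s).IsPeriodic) ∧ (∀ s k, (F s).side k = τ.side k) ∧
    (∀ k, Continuous fun s => (F s).pos k) ∧ F 0 = τ ∧
    ∃ m : ℤ, ∀ k, (F 1).side k = τ'.side (k + m) ∧ (F 1).pos k = τ'.pos (k + m)

end Trajectory

/-- A cylinder in direction `v`: a maximal family of parallel periodic trajectories. -/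
def IsCylinder (S : TranslationSurface ι n) (v : Plane) (C : Set (S.Trajectory v)) : Prop :=
  ∃ τ : S.Trajectory v, τ.IsPeriodic ∧ C = {τ' | τ.SameCylinder τ'}

def IsPeriodicDirection (S : TranslationSurface ι n) (v : Plane) : Prop :=
  ∃ τ : S.Trajectory v, τ.IsPeriodic

/-- `v` is the holonomy vector of a periodic trajectory, and no periodic trajectory in the
direction `v` is shorter. -/
def IsShortCylinderVector (S : TranslationSurface ι n) (v : Plane) : Prop :=
  (∃ τ : S.Trajectory v, τ.HasHolonomy v) ∧
    ∀ (τ : S.Trajectory v) (t : ℝ), τ.HasHolonomy (t • v) → 1 ≤ t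

end TranslationSurface

/-! ### The golden L -/

/-- The vertices of the rectangle with lower left corner `(x, y)`, width `w` and height `h`; its
sides `0, 1, 2, 3` are the bottom, right, top and left side. -/
def rectVertex (x y w h : ℝ) : Fin 4 → Plane :=
  ![![x, y], ![x + w, y], ![x + w, y + h], ![x, y + h]]

/-- The three pieces of the L: the unit square `0`, the rectangle `1` to the right of it, of width
`1/φ` and height `1`, and the rectangle `2` above it, of width `1` and height `1/φ`. -/
def goldenLVertex : Fin 3 → Fin 4 → Plane :=
  ![rectVertex 0 0 1 1,
    rectVertex 1 0 Real.goldenRatio⁻¹ 1,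
    rectVertex 0 1 1 Real.goldenRatio⁻¹]

/-- The piece to the right (equivalently, to the left) of a piece. -/
def besides : Fin 3 → Fin 3 := ![1, 0, 2]

/-- The piece above (equivalently, below) a piece. -/
def above : Fin 3 → Fin 3 := ![2, 1, 0]

def goldenLGlue (e : Fin 3 × Fin 4) : Fin 3 × Fin 4 :=
  ![(above e.1, 2), (besides e.1, 3), (above e.1, 0), (besides e.1, 1)] e.2

def goldenL : TranslationSurface (Fin 3) 4 where
  vertex := goldenLVertex
  glue := goldenLGlue
  convex := by
    have h := inv_pos.2 Real.goldenRatio_pos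
    have h3 : 0 < 1 + √(5 : ℝ) := by positivity
    intro i k j h1 h2
    fin_cases i <;> fin_cases k <;> fin_cases j <;>
      simp [goldenLVertex, rectVertex, cross] at h1 h2 ⊢ <;> first | exact h | linarith
  glue_glue := by decide
  glue_side := by
    rintro ⟨i, k⟩
    fin_cases i <;> fin_cases k <;> ext l <;> fin_cases l <;>
      simp [goldenLGlue, goldenLVertex, rectVertex, above, besides]

/-! ### The double pentagon -/

/-- The vertices, in counterclockwise order, of the regular pentagon with center `0`, a horizontal
bottom side, and diagonals of length `1` (so circumradius `1 / (2 sin (2π/5))`). -/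
def pentagonVertex (k : Fin 5) : Plane :=
  (2 * Real.sin (2 * Real.pi / 5))⁻¹ •
    ![-Real.sin (2 * Real.pi * k.val / 5), Real.cos (2 * Real.pi * k.val / 5)]

lemma pentagonVertex_eq : ∃ r c s : ℝ, 0 < r ∧ 0 < c ∧ c < 1 / 2 ∧ 0 < s ∧ 4 * c ^ 2 + 2 * c = 1 ∧
    s ^ 2 + c ^ 2 = 1 ∧ pentagonVertex =
      ![r • ![0, 1], r • ![-s, c], r • ![-(2 * s * c), 2 * c ^ 2 - 1],
        r • ![2 * s * c, 2 * c ^ 2 - 1], r • ![s, c]] := by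
  have hpi := Real.pi_pos
  have hcos : Real.cos (2 * Real.pi / 5) = 2 * Real.cos (Real.pi / 5) ^ 2 - 1 := by
    rw [← Real.cos_two_mul]; ring_nf
  rw [Real.cos_pi_div_five] at hcos
  have h5 : √(5 : ℝ) ^ 2 = 5 := Real.sq_sqrt (by norm_num)
  have h5' : (2 : ℝ) < √5 := Real.lt_sqrt_of_sq_lt (by norm_num)
  have h5'' : √(5 : ℝ) < 3 := (Real.sqrt_lt' (by norm_num)).2 (by norm_num)
  have hs : 0 < Real.sin (2 * Real.pi / 5) := Real.sin_pos_of_pos_of_lt_pi (by linarith) (by linarith)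
  have hs2 : Real.sin (2 * Real.pi * 2 / 5) =
      2 * Real.sin (2 * Real.pi / 5) * Real.cos (2 * Real.pi / 5) := by
    rw [← Real.sin_two_mul]; ring_nf
  have hc2 : Real.cos (2 * Real.pi * 2 / 5) = 2 * Real.cos (2 * Real.pi / 5) ^ 2 - 1 := by
    rw [← Real.cos_two_mul]; ring_nf
  have hs3 : Real.sin (2 * Real.pi * 3 / 5) = -Real.sin (2 * Real.pi * 2 / 5) := by
    rw [← Real.sin_two_pi_sub]; ring_nf
  have hc3 : Real.cos (2 * Real.pi * 3 / 5) = Real.cos (2 * Real.pi * 2 / 5) := by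
    rw [← Real.cos_two_pi_sub]; ring_nf
  have hs4 : Real.sin (2 * Real.pi * 4 / 5) = -Real.sin (2 * Real.pi / 5) := by
    rw [← Real.sin_two_pi_sub]; ring_nf
  have hc4 : Real.cos (2 * Real.pi * 4 / 5) = Real.cos (2 * Real.pi / 5) := by
    rw [← Real.cos_two_pi_sub]; ring_nf
  refine ⟨(2 * Real.sin (2 * Real.pi / 5))⁻¹, Real.cos (2 * Real.pi / 5),
    Real.sin (2 * Real.pi / 5), by positivity, by rw [hcos]; nlinarith, by rw [hcos]; nlinarith,
    hs, by rw [hcos]; nlinarith, Real.sin_sq_add_cos_sq _, ?_⟩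
  funext k
  fin_cases k
  · simp [pentagonVertex]
  · simp [pentagonVertex]
  · simp [pentagonVertex, hs2, hc2]
  · simp [pentagonVertex, hs3, hc3, hs2, hc2]
  · simp [pentagonVertex, hs4, hc4]

/-- The double pentagon: the pentagon above (`true`) and its reflected copy (`false`), each side
being glued to the opposite parallel side of the other pentagon. -/
def doublePentagon : TranslationSurface Bool 5 where
  vertex b k := bif b then pentagonVertex k else -pentagonVertex k
  glue e := (!e.1, e.2)
  convex := by
    obtain ⟨r, c, s, hr, hc, hc2, hs, h1, h2, h⟩ := pentagonVertex_eq
    have key : ∀ k j, j ≠ k → j ≠ k + 1 → 0 < cross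
        (pentagonVertex (k + 1) - pentagonVertex k) (pentagonVertex j - pentagonVertex k) := by
      rw [h]
      have hA : 0 < r ^ 2 * s := by positivity
      have hB : 0 < r ^ 2 * s * c := by positivity
      have hC : 0 < r ^ 2 * s * (1 - 2 * c) := mul_pos hA (by linarith)
      have e2 : r ^ 2 * s * (4 * c ^ 2 + 2 * c) = r ^ 2 * s * 1 := by rw [h1]
      have e3 : r ^ 2 * s * c * (4 * c ^ 2 + 2 * c) = r ^ 2 * s * c * 1 := by rw [h1]
      intro k j hj hj'
      fin_cases k <;> fin_cases j <;> simp [cross] at hj hj' ⊢ <;> nlinarith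
    intro b k j hj hj'
    have := key k j hj hj'
    cases b <;> simp [cross] at this ⊢ <;> linarith
  glue_glue := by simp
  glue_side := by
    rintro ⟨b, k⟩
    cases b <;> simp <;> abel

/-! ### The vectors of the theorem -/

/-- The positive cone `{(x, y) : x > 0, y ≥ 0}`. -/
def positiveCone : Set Plane := {u | 0 < u 0 ∧ 0 ≤ u 1}

/-- The short cylinder vectors of the golden L in the positive cone. -/
def Lambda : Set Plane := {v | goldenL.IsShortCylinderVector v} ∩ positiveCone

/-- The vector `[a + bφ, c + dφ]`. -/
def goldenVec (a b c d : ℕ) : Plane :=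
  ![a + b * Real.goldenRatio, c + d * Real.goldenRatio]

/-- The linear map `P` that takes the golden L to the double pentagon. -/
def shear (v : Plane) : Plane :=
  !![1, Real.cos (Real.pi / 5); 0, Real.sin (Real.pi / 5)].mulVec v

end PentagonL

end

open PentagonL

noncomputable section

namespace PentagonL

/-! A trajectory in direction `v` has a level, the cross product of `v` with its current point. It
is constant along a segment and changes at a crossing only by the translation that glues the side. A
line at a given level leaves a convex polygon through only one side. Hence one crossing determines
the whole trajectory (`eq_of_crossing_eq`), holonomy is the sum of the gluing translations over a
period (`hasHolonomy_iff`), and cylinders are the classes of periodic trajectories with the same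
side sequence up to renumbering (`sameCylinder_iff`).

Cutting the polygons along diagonals preserves cylinders and holonomy (`IsSubdivision.corr`); an
affine map preserves cylinders and acts linearly on holonomy (`IsAffine.corr`). The golden L and the
double pentagon have, up to `P`, a common triangulation, so their trajectories correspond
(`corr_goldenL_doublePentagon`). In particular the rotation of the pentagons by 2π/5 acts on the
directions of the L. Combined with the two reflections of the L it yields four linear maps that send
the cone Σ onto its sectors bounded by the slopes 0, 1/φ, 1, φ, ∞.

In a direction of Σ a trajectory leaves the pieces of the L only to the right or upwards, so its
holonomy has coordinates in ℕ + ℕφ. Such values are discrete, so a shortest holonomy exists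
(`exists_mem_Lambda`). A short vector that is not horizontal is the image, under one of the four
maps, of a short vector in Σ with smaller a + b + c + d. The descent ends in the horizontal
direction, where the two cylinders, of lengths 1 and φ, are visible (`hasTwoCylinders_goldenL`).

On the double pentagon the trajectories in question alternate between the pentagons and leave the
upright one only through the sides 3 and 4. The holonomy is a linear function of the crossing
numbers n₀, …, n₄ of the sides, and comparison of coefficients gives a + b + c + d = n₃ + n₄, half
the number of crossings (`hasCombinatorialPeriod_of_hasHolonomy`). The long cylinder follows from φv
= [b + (a+b)φ, d + (c+d)φ]. The index of an edge tells which pentagon is left, so the cutting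
sequence has no smaller period. -/

lemma cross_add_right (u w w' : Plane) : cross u (w + w') = cross u w + cross u w' := by
  simp [cross]; ring

lemma cross_sub_right (u w w' : Plane) : cross u (w - w') = cross u w - cross u w' := by
  simp [cross]; ring

lemma cross_smul_right (u w : Plane) (t : ℝ) : cross u (t • w) = t * cross u w := by
  simp [cross]; ring

lemma cross_neg_right (u w : Plane) : cross u (-w) = -cross u w := by
  simp [cross]; ring

lemma cross_neg_left (u w : Plane) : cross (-u) w = -cross u w := by
  simp [cross]; ring

lemma cross_comm (u w : Plane) : cross u w = -cross w u := by
  simp [cross]; ring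

lemma cross_self (u : Plane) : cross u u = 0 := by
  simp [cross]; ring

lemma exists_eq_smul_of_cross_eq_zero {v w : Plane} (hv : v ≠ 0) (h : cross v w = 0) :
    ∃ t : ℝ, w = t • v := by
  simp only [cross] at h
  by_cases h0 : v 0 = 0
  · have h1 : v 1 ≠ 0 := fun h1 => hv (by ext l; fin_cases l <;> simp [h0, h1])
    refine ⟨w 1 / v 1, ?_⟩
    have : w 0 = 0 := by
      rw [h0] at h
      simpa [h1] using h
    ext l
    fin_cases l
    · simp [h0, this]
    · simp [h1]
  · refine ⟨w 0 / v 0, ?_⟩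
    ext l
    fin_cases l
    · simp [h0]
    · simp
      field_simp
      linarith

/-! ### Cyclic indices and bi-infinite paths -/

lemma fin_add_one_ne {n : ℕ} [NeZero n] (hn : 3 ≤ n) (k : Fin n) : k + 1 ≠ k := by
  intro h
  have h1 : (1 : Fin n) = 0 := by simpa using h
  have := congrArg Fin.val h1
  rw [Fin.val_one', Fin.val_zero, Nat.mod_eq_of_lt (by omega)] at this
  omega

lemma fin_add_one_add_one_ne {n : ℕ} [NeZero n] (hn : 3 ≤ n) (k : Fin n) : k + 1 + 1 ≠ k := by
  intro h
  have h1 : (1 : Fin n) + 1 = 0 := by simpa [add_assoc] using h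
  have := congrArg Fin.val h1
  rw [Fin.val_add, Fin.val_one', Fin.val_zero, Nat.mod_eq_of_lt (a := 1) (by omega),
    Nat.mod_eq_of_lt (by omega)] at this
  omega

/-- Going once around the cycle `Fin n`, a function which takes values below and above `c`, but not
the value `c`, goes up through `c`. -/
lemma exists_lt_and_lt_add_one {n : ℕ} [NeZero n] {f : Fin n → ℝ} {c : ℝ} (hne : ∀ j, f j ≠ c)
    {a b : Fin n} (ha : f a < c) (hb : c < f b) : ∃ k, f k < c ∧ c < f (k + 1) := by
  by_contra! h
  -- If no step goes up through `c`, all values met on the way from `a` stay below `c`, including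
  -- the one at `b`.
  have key : ∀ m : ℕ, f (a + Fin.ofNat n m) < c := by
    intro m
    induction m with
    | zero => simpa using ha
    | succ m ih =>
      have e : a + Fin.ofNat n (m + 1) = a + Fin.ofNat n m + 1 := by
        rw [add_assoc]; congr 1
        ext; simp [Fin.val_add]
      rw [e]
      exact lt_of_le_of_ne (h _ ih) (hne _)
  have := key (b - a).val
  simp at this
  exact absurd this (not_lt.2 hb.le)

/-- A relation that is total on both sides has bi-infinite paths through each point. -/
lemma exists_int_path {G : Type*} (r : G → G → Prop) (h₁ : ∀ x, ∃ y, r x y) (h₂ : ∀ y, ∃ x, r x y)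
    (x₀ : G) : ∃ x : ℤ → G, x 0 = x₀ ∧ ∀ i, r (x i) (x (i + 1)) := by
  choose f hf using h₁
  choose g hg using h₂
  refine ⟨fun i => match i with
    | Int.ofNat m => f^[m] x₀
    | Int.negSucc m => g^[m + 1] x₀, rfl, fun i => ?_⟩
  match i with
  | Int.ofNat m =>
    have : (Int.ofNat m + 1 : ℤ) = Int.ofNat (m + 1) := rfl
    rw [this]
    simp only [Function.iterate_succ_apply']
    exact hf _
  | Int.negSucc 0 =>
    have : (Int.negSucc 0 + 1 : ℤ) = Int.ofNat 0 := rfl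
    rw [this]
    simpa using hg _
  | Int.negSucc (m + 1) =>
    have : (Int.negSucc (m + 1) + 1 : ℤ) = Int.negSucc m := rfl
    rw [this]
    simp only [Function.iterate_succ_apply' g (m + 1)]
    exact hg _

/-! ### Lines across convex polygons -/

namespace TranslationSurface

variable {ι : Type} {n : ℕ} [NeZero n]

/-- The vector from the start to the end of a side. -/
def edge (S : TranslationSurface ι n) (e : ι × Fin n) : Plane :=
  S.vertex e.1 (e.2 + 1) - S.vertex e.1 e.2

/-- The translation that brings the polygon glued to the side `e` into contact with `e`. -/
def disp (S : TranslationSurface ι n) (e : ι × Fin n) : Plane :=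
  S.vertex e.1 e.2 - S.vertex (S.glue e).1 ((S.glue e).2 + 1)

lemma edge_glue (S : TranslationSurface ι n) (e : ι × Fin n) : S.edge (S.glue e) = -S.edge e :=
  S.glue_side e

lemma point_eq (S : TranslationSurface ι n) (e : ι × Fin n) (t : ℝ) :
    S.point e t = S.vertex e.1 e.2 + t • S.edge e := rfl

lemma point_glue (S : TranslationSurface ι n) (e : ι × Fin n) (t : ℝ) :
    S.point (S.glue e) (1 - t) = S.point e t - S.disp e := by
  have h := S.edge_glue e
  have h' : S.vertex (S.glue e).1 ((S.glue e).2 + 1) =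
      S.vertex (S.glue e).1 (S.glue e).2 + S.edge (S.glue e) := by simp [edge]
  rw [point_eq, point_eq, disp, h', h]
  module

/-- The points at level `c` with respect to the direction `v` go up through the side `e`. -/
def Ascends (S : TranslationSurface ι n) (v : Plane) (c : ℝ) (i : ι) (k : Fin n) : Prop :=
  cross v (S.vertex i k) < c ∧ c < cross v (S.vertex i (k + 1))

/-- The points at level `c` with respect to the direction `v` go down through the side `e`. -/
def Descends (S : TranslationSurface ι n) (v : Plane) (c : ℝ) (i : ι) (k : Fin n) : Prop :=
  cross v (S.vertex i (k + 1)) < c ∧ c < cross v (S.vertex i k)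

section Convex

variable (S : TranslationSurface ι n) {v : Plane} {c : ℝ} {i : ι}

/-- The point is a combination with positive weights of the two ends of `k'`. Neither end is to the
right of the side `k`, and one is strictly to its left: the start of `k'`, or its end if `k' = k +
1`. -/
lemma cross_edge_point_pos (hn : 3 ≤ n) {k k' : Fin n} (hk : k' ≠ k) {t : ℝ}
    (ht : t ∈ Set.Ioo (0 : ℝ) 1) :
    0 < cross (S.edge (i, k)) (S.point (i, k') t - S.vertex i k) := by
  have e : S.point (i, k') t - S.vertex i k = (1 - t) • (S.vertex i k' - S.vertex i k) +
      t • (S.vertex i (k' + 1) - S.vertex i k) := by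
    rw [point]; module
  have h0 : ∀ j, 0 ≤ cross (S.edge (i, k)) (S.vertex i j - S.vertex i k) := by
    intro j
    by_cases h1 : j = k
    · simp [h1, cross]
    by_cases h2 : j = k + 1
    · rw [h2]; exact (cross_self _).ge
    exact (S.convex i k j h1 h2).le
  have t1 : 0 < 1 - t := sub_pos.2 ht.2
  rw [e, cross_add_right, cross_smul_right, cross_smul_right]
  by_cases h2 : k' = k + 1
  · have := S.convex i k (k' + 1) (by rw [h2]; exact fin_add_one_add_one_ne hn k)
      (by rw [h2]; exact fin_add_one_ne hn _)
    exact add_pos_of_nonneg_of_pos (mul_nonneg t1.le (h0 _)) (mul_pos ht.1 this)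
  · exact add_pos_of_pos_of_nonneg (mul_pos t1 (S.convex i k k' hk h2))
      (mul_nonneg ht.1.le (h0 _))

variable {S}

lemma Ascends.cross_pos {k : Fin n} (h : S.Ascends v c i k) : 0 < cross v (S.edge (i, k)) := by
  rw [edge, cross_sub_right]; linarith [h.1, h.2]

lemma Descends.cross_neg {k : Fin n} (h : S.Descends v c i k) : cross v (S.edge (i, k)) < 0 := by
  rw [edge, cross_sub_right]; linarith [h.1, h.2]

lemma Ascends.exists_point {k : Fin n} (h : S.Ascends v c i k) :
    ∃ t ∈ Set.Ioo (0 : ℝ) 1, cross v (S.point (i, k) t) = c := by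
  have hp := h.cross_pos
  have h2 := h.2
  have h1 := h.1
  have e : cross v (S.edge (i, k)) = cross v (S.vertex i (k + 1)) - cross v (S.vertex i k) := by
    rw [edge, cross_sub_right]
  refine ⟨(c - cross v (S.vertex i k)) / cross v (S.edge (i, k)), ⟨by apply div_pos <;> linarith,
    by rw [div_lt_one hp]; linarith⟩, ?_⟩
  rw [point_eq, cross_add_right, cross_smul_right, div_mul_cancel₀ _ hp.ne']
  simp

lemma Descends.neg {k : Fin n} (h : S.Descends v c i k) : S.Ascends (-v) (-c) i k := by
  constructor <;> rw [cross_neg_left] <;> linarith [h.1, h.2]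

lemma Descends.exists_point {k : Fin n} (h : S.Descends v c i k) :
    ∃ t ∈ Set.Ioo (0 : ℝ) 1, cross v (S.point (i, k) t) = c := by
  obtain ⟨t, ht, e⟩ := h.neg.exists_point
  rw [cross_neg_left] at e
  exact ⟨t, ht, by linarith⟩

lemma ne_zero_of_cross_ne_zero {v w : Plane} (h : cross v w ≠ 0) : v ≠ 0 := by
  rintro rfl
  simp [cross] at h

/-- Between two points of a convex polygon on different sides and at the same level, one crosses the
polygon in the direction `v` from a descending side or to an ascending one. -/
lemma cross_edge_smul_pos (hn : 3 ≤ n) {k k' : Fin n} (hk : k' ≠ k) {s t r : ℝ}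
    (ht : t ∈ Set.Ioo (0 : ℝ) 1) (h : S.point (i, k') t = S.point (i, k) s + r • v) :
    0 < r * cross (S.edge (i, k)) v := by
  have := S.cross_edge_point_pos hn (i := i) hk ht
  rw [h, point_eq] at this
  have e : S.vertex i k + s • S.edge (i, k) + r • v - S.vertex i k = s • S.edge (i, k) + r • v := by
    module
  simp only at this
  rwa [e, cross_add_right, cross_smul_right, cross_smul_right, cross_self, mul_zero, zero_add]
    at this

/-- The chord between the two crossing points would be parallel to `v`, and an ascending side is
reached, never left, by a chord directed like `v`. This cannot hold at both ends. -/
lemma Ascends.unique (hn : 3 ≤ n) {k k' : Fin n} (h : S.Ascends v c i k) (h' : S.Ascends v c i k') :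
    k = k' := by
  by_contra hk
  have hv : v ≠ 0 := ne_zero_of_cross_ne_zero h.cross_pos.ne'
  obtain ⟨s, hs, es⟩ := h.exists_point
  obtain ⟨t, ht, et⟩ := h'.exists_point
  obtain ⟨r, hr⟩ := exists_eq_smul_of_cross_eq_zero hv
    (show cross v (S.point (i, k') t - S.point (i, k) s) = 0 by rw [cross_sub_right, es, et]; ring)
  have h1 := cross_edge_smul_pos hn (Ne.symm hk) ht (sub_eq_iff_eq_add'.1 hr)
  have h2 := cross_edge_smul_pos (r := -r) (v := v) hn hk hs
    (by rw [sub_eq_iff_eq_add'.1 hr]; module)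
  rw [cross_comm] at h1 h2
  have p1 := h.cross_pos
  have p2 := h'.cross_pos
  nlinarith

lemma Descends.unique (hn : 3 ≤ n) {k k' : Fin n} (h : S.Descends v c i k)
    (h' : S.Descends v c i k') : k = k' :=
  h.neg.unique hn h'.neg

/-- The line at level `c` that crosses a polygon does not meet its vertices. -/
lemma Ascends.vertex_ne (hn : 3 ≤ n) {k k' : Fin n} (h' : S.Ascends v c i k')
    (h : S.Descends v c i k) (j : Fin n) : cross v (S.vertex i j) ≠ c := by
  intro hj
  have hv : v ≠ 0 := ne_zero_of_cross_ne_zero h.cross_neg.ne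
  have j1 : j ≠ k := by rintro rfl; exact h.2.ne' hj
  have j2 : j ≠ k + 1 := by rintro rfl; exact h.1.ne hj
  have j3 : j ≠ k' := by rintro rfl; exact h'.1.ne hj
  have j4 : j ≠ k' + 1 := by rintro rfl; exact h'.2.ne' hj
  obtain ⟨s, hs, es⟩ := h.exists_point
  obtain ⟨t, ht, et⟩ := h'.exists_point
  obtain ⟨r, hr⟩ := exists_eq_smul_of_cross_eq_zero hv
    (show cross v (S.point (i, k) s - S.vertex i j) = 0 by rw [cross_sub_right, es, hj]; ring)
  obtain ⟨r', hr'⟩ := exists_eq_smul_of_cross_eq_zero hv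
    (show cross v (S.point (i, k') t - S.vertex i j) = 0 by rw [cross_sub_right, et, hj]; ring)
  -- Both crossing points lie strictly to the left of the side that starts at the vertex `j`.
  -- Convexity at `k` and `k'` will put this vertex strictly between them (`r < 0 < r'`), a
  -- contradiction.
  have a1 := S.cross_edge_point_pos hn (i := i) (Ne.symm j1) hs
  have a2 := S.cross_edge_point_pos hn (i := i) (Ne.symm j3) ht
  rw [hr, cross_smul_right] at a1
  rw [hr', cross_smul_right] at a2
  have b1 := S.convex i k j j1 j2
  have b2 := S.convex i k' j j3 j4
  have e1 : S.vertex i j - S.vertex i k = s • S.edge (i, k) - r • v := by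
    rw [← hr, point_eq]; module
  have e2 : S.vertex i j - S.vertex i k' = t • S.edge (i, k') - r' • v := by
    rw [← hr', point_eq]; module
  change 0 < cross (S.edge (i, k)) _ at b1
  change 0 < cross (S.edge (i, k')) _ at b2
  rw [e1, cross_sub_right, cross_smul_right, cross_smul_right, cross_self, cross_comm _ v] at b1
  rw [e2, cross_sub_right, cross_smul_right, cross_smul_right, cross_self, cross_comm _ v] at b2
  have p1 := h.cross_neg
  have p2 := h'.cross_pos
  have r1 : r < 0 := by nlinarith
  have r2 : 0 < r' := by nlinarith
  rcases lt_or_ge 0 (cross (S.edge (i, j)) v) with q | q <;> nlinarith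

end Convex

/-! ### Trajectories as sequences of sides and levels -/

namespace Trajectory

variable {S : TranslationSurface ι n} {v : Plane}

/-- The level of a crossing with respect to the direction of the trajectory, in the coordinates of
the polygon that is left. -/
def level (τ : S.Trajectory v) (k : ℤ) : ℝ := cross v (S.point (τ.side k) (τ.pos k))

lemma point_succ (τ : S.Trajectory v) (k : ℤ) : S.point (τ.side (k + 1)) (τ.pos (k + 1)) =
    S.point (τ.side k) (τ.pos k) - S.disp (τ.side k) + τ.time k • v := by
  rw [τ.segment, point_glue]

/-- Motion along `v` does not change the cross product with `v`; only the change of polygon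
coordinates does. -/
lemma level_succ (τ : S.Trajectory v) (k : ℤ) :
    τ.level (k + 1) = τ.level k - cross v (S.disp (τ.side k)) := by
  rw [level, point_succ, cross_add_right, cross_sub_right, cross_smul_right, cross_self]
  simp [level]

/-- The segment that ends at the crossing comes from another side of the same polygon, hence from
the left of the crossed side. -/
lemma cross_edge_pos (hn : 3 ≤ n) (τ : S.Trajectory v) (k : ℤ) :
    0 < cross v (S.edge (τ.side k)) := by
  obtain ⟨k, rfl⟩ : ∃ m, k = m + 1 := ⟨k - 1, by ring⟩
  have h1 := τ.segment k
  have h2 := τ.side_ne k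
  have h3 := τ.same_polygon k
  have h4 := τ.time_pos k
  generalize τ.side (k + 1) = e at *
  generalize S.glue (τ.side k) = g at *
  obtain ⟨i, a⟩ := g
  obtain ⟨i', b⟩ := e
  obtain rfl : i = i' := h3
  have hm := τ.pos_mem k
  have := cross_edge_smul_pos (v := v) (r := -τ.time k) hn (i := i) (k := b) (k' := a)
    (s := τ.pos (k + 1)) (t := 1 - τ.pos k)
    (by rintro rfl; exact h2 rfl) ⟨by linarith [hm.2], by linarith [hm.1]⟩ (by rw [h1]; module)
  rw [cross_comm] at this
  nlinarith

lemma ascends (hn : 3 ≤ n) (τ : S.Trajectory v) (k : ℤ) :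
    S.Ascends v (τ.level k) (τ.side k).1 (τ.side k).2 := by
  have h := τ.cross_edge_pos hn k
  have e : cross v (S.edge (τ.side k)) = cross v (S.vertex (τ.side k).1 ((τ.side k).2 + 1)) -
      cross v (S.vertex (τ.side k).1 (τ.side k).2) := by rw [edge, cross_sub_right]
  have hm := τ.pos_mem k
  rw [level, point_eq, cross_add_right, cross_smul_right]
  constructor <;> nlinarith [hm.1, hm.2]

end Trajectory

lemma Ascends.descends_glue {S : TranslationSurface ι n} {v : Plane} {c : ℝ} {e : ι × Fin n}
    (h : S.Ascends v c e.1 e.2) :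
    S.Descends v (c - cross v (S.disp e)) (S.glue e).1 (S.glue e).2 := by
  have h1 := S.edge_glue e
  have h2 : cross v (S.edge (S.glue e)) = -cross v (S.edge e) := by rw [h1, cross_neg_right]
  simp only [edge, disp, cross_sub_right] at *
  constructor <;> linarith [h.1, h.2]

lemma Descends.ascends_glue {S : TranslationSurface ι n} {v : Plane} {c : ℝ} {e : ι × Fin n}
    (h : S.Descends v c e.1 e.2) :
    S.Ascends v (c - cross v (S.disp e)) (S.glue e).1 (S.glue e).2 := by
  have h1 := S.edge_glue e
  have h2 : cross v (S.edge (S.glue e)) = -cross v (S.edge e) := by rw [h1, cross_neg_right]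
  simp only [edge, disp, cross_sub_right] at *
  constructor <;> linarith [h.1, h.2]

lemma disp_glue (S : TranslationSurface ι n) (e : ι × Fin n) : S.disp (S.glue e) = -S.disp e := by
  have h1 := S.edge_glue e
  simp only [edge, disp, S.glue_glue] at *
  rw [sub_eq_iff_eq_add] at h1
  rw [h1]
  abel

namespace Trajectory

variable {S : TranslationSurface ι n} {v : Plane}

lemma descends_glue (hn : 3 ≤ n) (τ : S.Trajectory v) (k : ℤ) :
    S.Descends v (τ.level (k + 1)) (S.glue (τ.side k)).1 (S.glue (τ.side k)).2 := by
  rw [level_succ]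
  exact (τ.ascends hn k).descends_glue

/-- A sequence of sides that are crossed at the levels `c` belongs to a trajectory. -/
theorem exists_of_levels (hn : 3 ≤ n) (e : ℤ → ι × Fin n) (c : ℤ → ℝ)
    (hc : ∀ k, S.Ascends v (c k) (e k).1 (e k).2) (he : ∀ k, (S.glue (e k)).1 = (e (k + 1)).1)
    (hs : ∀ k, c (k + 1) = c k - cross v (S.disp (e k))) :
    ∃ τ : S.Trajectory v, (∀ k, τ.side k = e k) ∧ ∀ k, τ.level k = c k := by
  have hv : v ≠ 0 := ne_zero_of_cross_ne_zero (hc 0).cross_pos.ne'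
  choose p hp hpc using fun k => (hc k).exists_point
  have hd : ∀ k, S.Descends v (c (k + 1)) (S.glue (e k)).1 (S.glue (e k)).2 := fun k => by
    rw [hs]; exact (hc k).descends_glue
  have hne : ∀ k, S.glue (e k) ≠ e (k + 1) := by
    intro k h
    have h1 := hd k
    rw [h] at h1
    exact lt_asymm h1.cross_neg (hc (k + 1)).cross_pos
  have ht : ∀ k, ∃ t : ℝ, S.point (e (k + 1)) (p (k + 1)) -
      S.point (S.glue (e k)) (1 - p k) = t • v := by
    intro k
    refine exists_eq_smul_of_cross_eq_zero hv ?_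
    rw [point_glue, cross_sub_right, cross_sub_right, hpc (k + 1), hpc k, hs]
    ring
  choose t ht using ht
  refine ⟨⟨e, p, t, hp, fun k => ?_, he, hne, fun k => sub_eq_iff_eq_add'.1 (ht k)⟩,
    fun k => rfl, hpc⟩
  have h1 := hd k
  have h2 := sub_eq_iff_eq_add'.1 (ht k)
  have h3 := hp (k + 1)
  have h4 := he k
  have h5 := hne k
  generalize e (k + 1) = g at *
  generalize S.glue (e k) = f at *
  obtain ⟨i, a⟩ := g
  obtain ⟨i', b⟩ := f
  obtain rfl : i' = i := h4
  -- The segment starts on a descending side, and this forces its time to be positive.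
  have := cross_edge_smul_pos hn (i := i') (k := b) (k' := a) (by rintro rfl; exact h5 rfl) h3 h2
  have h6 := h1.cross_neg
  rw [cross_comm] at this
  nlinarith

lemma pos_eq_of_level_eq (hn : 3 ≤ n) {τ σ : S.Trajectory v} {k m : ℤ}
    (h : τ.side k = σ.side m) (h' : τ.level k = σ.level m) : τ.pos k = σ.pos m := by
  have := (τ.cross_edge_pos hn k).ne'
  rw [level, level, point_eq, point_eq, cross_add_right, cross_add_right, cross_smul_right,
    cross_smul_right, ← h] at h'
  exact mul_right_cancel₀ this (add_left_cancel h')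

lemma level_eq_of_pos_eq {τ σ : S.Trajectory v} {k m : ℤ}
    (h : τ.side k = σ.side m) (h' : τ.pos k = σ.pos m) : τ.level k = σ.level m := by
  rw [level, level, h, h']

/-- A trajectory is determined by one crossing. -/
theorem eq_of_crossing_eq (hn : 3 ≤ n) {τ σ : S.Trajectory v} {k m : ℤ} (h : τ.side k = σ.side m)
    (h' : τ.pos k = σ.pos m) (i : ℤ) :
    τ.side (k + i) = σ.side (m + i) ∧ τ.pos (k + i) = σ.pos (m + i) := by
  suffices ∀ i, τ.side (k + i) = σ.side (m + i) ∧ τ.level (k + i) = σ.level (m + i) from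
    ⟨(this i).1, pos_eq_of_level_eq hn (this i).1 (this i).2⟩
  intro i
  -- Forwards, the next side is the only ascending one of the polygon that is entered; backwards,
  -- the glued side of the previous crossing is the only descending one.
  induction i using Int.induction_on with
  | zero => simpa using ⟨h, level_eq_of_pos_eq h h'⟩
  | succ i ih =>
    rw [← add_assoc, ← add_assoc]
    have hl : τ.level (k + i + 1) = σ.level (m + i + 1) := by
      rw [level_succ, level_succ, ih.1, ih.2]
    have h1 := τ.ascends hn (k + i + 1)
    have h2 := σ.ascends hn (m + i + 1)
    have h3 : (τ.side (k + i + 1)).1 = (σ.side (m + i + 1)).1 := by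
      rw [← τ.same_polygon, ← σ.same_polygon, ih.1]
    rw [hl, h3] at h1
    exact ⟨Prod.ext h3 (h1.unique hn h2), hl⟩
  | pred i ih =>
    have e1 : k + (-(i : ℤ)) = k + (-(i : ℤ) - 1) + 1 := by ring
    have e2 : m + (-(i : ℤ)) = m + (-(i : ℤ) - 1) + 1 := by ring
    rw [e1, e2] at ih
    have h1 := τ.descends_glue hn (k + (-(i : ℤ) - 1))
    have h2 := σ.descends_glue hn (m + (-(i : ℤ) - 1))
    have h3 : (S.glue (τ.side (k + (-(i : ℤ) - 1)))).1 = (S.glue (σ.side (m + (-(i : ℤ) - 1)))).1 := by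
      rw [τ.same_polygon, σ.same_polygon, ih.1]
    rw [ih.2, h3] at h1
    have h4 := Prod.ext h3 (h1.unique hn h2)
    have h5 : τ.side (k + (-(i : ℤ) - 1)) = σ.side (m + (-(i : ℤ) - 1)) := by
      rw [← S.glue_glue (τ.side _), h4, S.glue_glue]
    refine ⟨h5, ?_⟩
    have h6 := ih.2
    rw [level_succ, level_succ, h5] at h6
    linarith

end Trajectory
end TranslationSurface

/-! ### Periodicity, holonomy and cylinders in terms of side sequences -/

lemma sum_range_add_int_eq {M : Type*} [AddCommGroup M] (f : ℤ → M) {N : ℕ}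
    (hf : ∀ k, f (k + N) = f k) (m : ℤ) :
    ∑ k ∈ Finset.range N, f (k + m) = ∑ k ∈ Finset.range N, f k := by
  have step : ∀ m : ℤ, ∑ k ∈ Finset.range N, f (k + (m + 1)) = ∑ k ∈ Finset.range N, f (k + m) := by
    intro m
    have h1 := Finset.sum_range_succ (fun k : ℕ => f (k + m)) N
    rw [Finset.sum_range_succ'] at h1
    have h2 : f (N + m) = f m := by rw [add_comm, hf]
    simp only [h2, Nat.cast_zero, zero_add] at h1
    rw [← add_right_cancel h1]
    refine Finset.sum_congr rfl fun k _ => ?_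
    push_cast
    congr 1
    ring
  induction m using Int.induction_on with
  | zero => simp
  | succ i ih => rw [step, ih]
  | pred i ih => rw [← ih, ← step]; simp

namespace TranslationSurface

variable {ι : Type} {n : ℕ} [NeZero n]

namespace Trajectory

variable {S : TranslationSurface ι n} {v : Plane}

/-- The same trajectory with the crossings renumbered. -/
def shift (τ : S.Trajectory v) (m : ℤ) : S.Trajectory v where
  side k := τ.side (k + m)
  pos k := τ.pos (k + m)
  time k := τ.time (k + m)
  pos_mem k := τ.pos_mem _
  time_pos k := τ.time_pos _
  same_polygon k := by rw [add_right_comm]; exact τ.same_polygon _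
  side_ne k := by rw [add_right_comm]; exact τ.side_ne _
  segment k := by rw [add_right_comm]; exact τ.segment _

/-- Two trajectories cross the same sides, up to renumbering. -/
def SameSides (τ σ : S.Trajectory v) : Prop := ∃ m : ℤ, ∀ k, τ.side k = σ.side (k + m)

lemma SameSides.refl (τ : S.Trajectory v) : τ.SameSides τ := ⟨0, by simp⟩

lemma SameSides.symm {τ σ : S.Trajectory v} (h : τ.SameSides σ) : σ.SameSides τ := by
  obtain ⟨m, hm⟩ := h
  exact ⟨-m, fun k => by rw [hm]; simp⟩

lemma SameSides.trans {τ σ ρ : S.Trajectory v} (h : τ.SameSides σ) (h' : σ.SameSides ρ) :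
    τ.SameSides ρ := by
  obtain ⟨m, hm⟩ := h
  obtain ⟨m', hm'⟩ := h'
  exact ⟨m + m', fun k => by rw [hm, hm', add_assoc]⟩

lemma sameSides_of_crossing_eq (hn : 3 ≤ n) {τ σ : S.Trajectory v} {k m : ℤ}
    (h : τ.side k = σ.side m) (h' : τ.pos k = σ.pos m) : τ.SameSides σ := by
  refine ⟨m - k, fun i => ?_⟩
  have := (eq_of_crossing_eq hn h h' (i - k)).1
  convert this using 2 <;> ring

/-- A sequence of sides that repeats belongs to a trajectory that closes up. -/
lemma closesAfter_iff_side (hn : 3 ≤ n) (τ : S.Trajectory v) (M : ℕ) :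
    τ.ClosesAfter M ↔ 0 < M ∧ ∀ k : ℤ, τ.side (k + M) = τ.side k := by
  refine ⟨fun h => ⟨h.1, fun k => (h.2 k).1⟩, fun ⟨h0, h⟩ => ⟨h0, fun k => ⟨h k, ?_⟩⟩⟩
  refine pos_eq_of_level_eq hn (h k) ?_
  -- When the sides repeat, the level changes by the same amount `δ` over every `M` crossings. A
  -- nonzero `δ` would accumulate, although the levels on one fixed side are bounded.
  have step : ∀ i : ℤ, τ.level (i + 1 + M) - τ.level (i + 1) = τ.level (i + M) - τ.level i := by
    intro i
    rw [add_right_comm, level_succ, level_succ, h]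
    ring
  have const : ∀ i j : ℤ, τ.level (i + j + M) - τ.level (i + j) = τ.level (i + M) - τ.level i := by
    intro i j
    induction j using Int.induction_on with
    | zero => simp
    | succ j ih => rw [← ih, ← add_assoc, step]
    | pred j ih => rw [← ih, ← step]; ring_nf
  have hmul : ∀ m : ℕ, τ.level (k + m * M) = τ.level k + m * (τ.level (k + M) - τ.level k) ∧
      τ.side (k + m * M) = τ.side k := by
    intro m
    induction m with
    | zero => simp
    | succ m ih =>
      have e : k + ((m + 1 : ℕ) : ℤ) * M = k + m * M + M := by push_cast; ring
      rw [e, h, ih.2]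
      refine ⟨?_, rfl⟩
      have := const k (m * M)
      push_cast
      linarith [ih.1]
  set δ := τ.level (k + M) - τ.level k with hδ
  suffices δ = 0 by linarith
  by_contra hne
  have hb := τ.ascends hn k
  obtain ⟨m, hm⟩ := exists_nat_gt ((cross v (S.vertex (τ.side k).1 ((τ.side k).2 + 1)) -
    cross v (S.vertex (τ.side k).1 (τ.side k).2)) / |δ|)
  rw [div_lt_iff₀ (abs_pos.2 hne)] at hm
  have hb' := τ.ascends hn (k + m * M)
  rw [(hmul m).1, (hmul m).2] at hb'
  have : |m * δ| < cross v (S.vertex (τ.side k).1 ((τ.side k).2 + 1)) -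
      cross v (S.vertex (τ.side k).1 (τ.side k).2) := by
    rw [abs_lt]; constructor <;> linarith [hb.1, hb.2, hb'.1, hb'.2]
  rw [abs_mul, Nat.abs_cast] at this
  linarith

lemma SameSides.closesAfter (hn : 3 ≤ n) {τ σ : S.Trajectory v} (h : τ.SameSides σ) {N : ℕ}
    (hN : τ.ClosesAfter N) : σ.ClosesAfter N := by
  obtain ⟨m, hm⟩ := h.symm
  rw [closesAfter_iff_side hn] at hN ⊢
  refine ⟨hN.1, fun k => ?_⟩
  rw [hm, hm, add_right_comm, hN.2]

lemma SameSides.hasCombinatorialPeriod (hn : 3 ≤ n) {τ σ : S.Trajectory v} (h : τ.SameSides σ)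
    {N : ℕ} (hN : τ.HasCombinatorialPeriod N) : σ.HasCombinatorialPeriod N :=
  ⟨h.closesAfter hn hN.1, fun _ hM => hN.2 (h.symm.closesAfter hn hM)⟩

lemma IsPeriodic.exists_period {τ : S.Trajectory v} (h : τ.IsPeriodic) :
    ∃ N, τ.HasCombinatorialPeriod N := by
  classical
  exact ⟨Nat.find h, Nat.find_spec h, fun _ hM => Nat.find_min' h hM⟩

lemma closesAfter_of_crossing_eq (hn : 3 ≤ n) {τ : S.Trajectory v} {k : ℤ} {N : ℕ} (hN : 0 < N)
    (h : τ.side (k + N) = τ.side k) (h' : τ.pos (k + N) = τ.pos k) : τ.ClosesAfter N := by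
  refine ⟨hN, fun i => ?_⟩
  have := eq_of_crossing_eq hn h h' (i - k)
  rw [show k + N + (i - k) = i + N by ring, show k + (i - k) = i by ring] at this
  exact this

/-- The crossing points telescope and the last one equals the first, so the displacements along `v`
and the gluing translations balance. Holonomy thus depends on the side sequence only. -/
lemma ClosesAfter.sum_time_smul {τ : S.Trajectory v} {N : ℕ} (h : τ.ClosesAfter N) :
    (∑ k ∈ Finset.range N, τ.time k) • v = ∑ k ∈ Finset.range N, S.disp (τ.side k) := by
  have key : ∀ M : ℕ, S.point (τ.side M) (τ.pos M) = S.point (τ.side 0) (τ.pos 0) -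
      ∑ k ∈ Finset.range M, S.disp (τ.side k) + (∑ k ∈ Finset.range M, τ.time k) • v := by
    intro M
    induction M with
    | zero => simp
    | succ M ih =>
      push_cast
      rw [point_succ, ih, Finset.sum_range_succ, Finset.sum_range_succ]
      module
  have h1 := key N
  have h2 := h.2 0
  rw [zero_add] at h2
  rw [h2.1, h2.2, sub_add, eq_comm, sub_eq_self] at h1
  exact (sub_eq_zero.1 h1).symm

lemma hasHolonomy_iff {τ : S.Trajectory v} {h : Plane} : τ.HasHolonomy h ↔
    ∃ N, τ.HasCombinatorialPeriod N ∧ h = ∑ k ∈ Finset.range N, S.disp (τ.side k) := by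
  refine exists_congr fun N => and_congr_right fun hN => ?_
  rw [hN.1.sum_time_smul]

lemma SameSides.hasHolonomy (hn : 3 ≤ n) {τ σ : S.Trajectory v} (hs : τ.SameSides σ) {h : Plane}
    (hh : τ.HasHolonomy h) : σ.HasHolonomy h := by
  rw [hasHolonomy_iff] at hh ⊢
  obtain ⟨N, hN, rfl⟩ := hh
  refine ⟨N, hs.hasCombinatorialPeriod hn hN, ?_⟩
  obtain ⟨m, hm⟩ := hs.symm
  simp only [hm]
  exact (sum_range_add_int_eq (fun k => S.disp (τ.side k)) (fun k => by simp [hN.1.2]) m).symm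

lemma IsPeriodic.exists_holonomy {τ : S.Trajectory v} (h : τ.IsPeriodic) :
    ∃ t : ℝ, 0 < t ∧ τ.HasHolonomy (t • v) := by
  obtain ⟨N, hN⟩ := h.exists_period
  exact ⟨∑ k ∈ Finset.range N, τ.time k, Finset.sum_pos (fun k _ => τ.time_pos k)
    ⟨0, Finset.mem_range.2 hN.1.1⟩, N, hN, rfl⟩

lemma HasHolonomy.isPeriodic {τ : S.Trajectory v} {h : Plane} (hh : τ.HasHolonomy h) :
    τ.IsPeriodic := by
  obtain ⟨N, hN, -⟩ := hh
  exact ⟨N, hN.1⟩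

lemma HasHolonomy.unique {τ : S.Trajectory v} {h h' : Plane} (hh : τ.HasHolonomy h)
    (hh' : τ.HasHolonomy h') : h = h' := by
  obtain ⟨N, hN, rfl⟩ := hh
  obtain ⟨N', hN', rfl⟩ := hh'
  rw [hN.unique hN']

/-- The convex combination of two trajectories that cross the same sides. -/
def interpolate (τ σ : S.Trajectory v) (h : ∀ k, τ.side k = σ.side k) (s : ℝ)
    (hs : s ∈ Set.Icc (0 : ℝ) 1) : S.Trajectory v where
  side := τ.side
  pos k := (1 - s) * τ.pos k + s * σ.pos k
  time k := (1 - s) * τ.time k + s * σ.time k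
  pos_mem k := convex_Ioo (0 : ℝ) 1 (τ.pos_mem k) (σ.pos_mem k) (sub_nonneg.2 hs.2) hs.1 (by ring)
  time_pos k := convex_Ioi (0 : ℝ) (τ.time_pos k) (σ.time_pos k) (sub_nonneg.2 hs.2) hs.1 (by ring)
  same_polygon := τ.same_polygon
  side_ne := τ.side_ne
  segment k := by
    have h1 := τ.segment k
    have h2 := σ.segment k
    rw [← h, ← h] at h2
    simp only [point_eq] at *
    ext l
    have h1' := congrFun h1 l
    have h2' := congrFun h2 l
    simp only [Pi.add_apply, Pi.smul_apply, smul_eq_mul] at *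
    linear_combination (1 - s) * h1' + s * h2'

/-- The periodic trajectories of a cylinder are those that cross the same sides. -/
theorem sameCylinder_iff (hn : 3 ≤ n) {τ σ : S.Trajectory v} (hτ : τ.IsPeriodic) :
    τ.SameCylinder σ ↔ τ.SameSides σ := by
  constructor
  · rintro ⟨F, -, h, -, -, m, hm⟩
    exact ⟨m, fun k => by rw [← h 1, (hm k).1]⟩
  · rintro ⟨m, hm⟩
    obtain ⟨N, hN⟩ := hτ
    rw [closesAfter_iff_side hn] at hN
    -- The straight-line homotopy keeps the side sequence, and with it the periodicity.
    refine ⟨fun s => τ.interpolate (σ.shift m) hm s s.2, fun s => ⟨N, ?_⟩, fun s k => rfl,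
      fun k => ?_, ?_, m, fun k => ⟨hm k, ?_⟩⟩
    · rwa [closesAfter_iff_side hn]
    · simp only [interpolate]
      fun_prop
    · ext <;> simp [interpolate]
    · simp [interpolate, shift]

end Trajectory

/-! ### Correspondences between the trajectories on two surfaces -/

/-- The trajectories in direction `v` on `S` correspond to those in direction `v'` on `S'`, with the
same cylinders and with holonomy vectors related by the linear map `A`. -/
def Corr {ι' : Type} {n' : ℕ} [NeZero n'] (S : TranslationSurface ι n) (v : Plane)
    (S' : TranslationSurface ι' n') (v' : Plane) (A : Plane ≃ₗ[ℝ] Plane) : Prop :=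
  ∃ R : S.Trajectory v → S'.Trajectory v' → Prop, (∀ τ, ∃ τ', R τ τ') ∧ (∀ τ', ∃ τ, R τ τ') ∧
    (∀ τ τ' σ σ', R τ τ' → R σ σ' → (τ.SameSides σ ↔ τ'.SameSides σ')) ∧
    ∀ τ τ' h, R τ τ' → (τ.HasHolonomy h ↔ τ'.HasHolonomy (A h))

section Corr

variable {ι₁ ι₂ ι₃ : Type} {n₁ n₂ n₃ : ℕ} [NeZero n₁] [NeZero n₂] [NeZero n₃]
  {S₁ : TranslationSurface ι₁ n₁} {S₂ : TranslationSurface ι₂ n₂} {S₃ : TranslationSurface ι₃ n₃}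
  {v₁ v₂ v₃ : Plane} {A B : Plane ≃ₗ[ℝ] Plane}

lemma Corr.symm (h : Corr S₁ v₁ S₂ v₂ A) : Corr S₂ v₂ S₁ v₁ A.symm := by
  obtain ⟨R, h1, h2, h3, h4⟩ := h
  exact ⟨fun τ' τ => R τ τ', h2, h1, fun τ τ' σ σ' h h' => (h3 _ _ _ _ h h').symm,
    fun τ τ' w h => by simp [h4 _ _ _ h]⟩

lemma Corr.trans (h : Corr S₁ v₁ S₂ v₂ A) (h' : Corr S₂ v₂ S₃ v₃ B) :
    Corr S₁ v₁ S₃ v₃ (A.trans B) := by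
  obtain ⟨R, h1, h2, h3, h4⟩ := h
  obtain ⟨R', h1', h2', h3', h4'⟩ := h'
  refine ⟨fun τ ρ => ∃ σ, R τ σ ∧ R' σ ρ, fun τ => ?_, fun ρ => ?_, ?_, ?_⟩
  · obtain ⟨σ, hσ⟩ := h1 τ
    obtain ⟨ρ, hρ⟩ := h1' σ
    exact ⟨ρ, σ, hσ, hρ⟩
  · obtain ⟨σ, hσ⟩ := h2' ρ
    obtain ⟨τ, hτ⟩ := h2 σ
    exact ⟨τ, σ, hτ, hσ⟩
  · rintro τ ρ τ' ρ' ⟨σ, a, b⟩ ⟨σ', a', b'⟩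
    rw [h3 _ _ _ _ a a', h3' _ _ _ _ b b']
  · rintro τ ρ w ⟨σ, a, b⟩
    rw [h4 _ _ _ a, h4' _ _ _ b]
    rfl

/-- There are two cylinders in the direction `v`, with holonomy vectors `h₁` and `h₂`. -/
def HasTwoCylinders (S : TranslationSurface ι n) (v h₁ h₂ : Plane) : Prop :=
  ∃ τ₁ τ₂ : S.Trajectory v, τ₁.HasHolonomy h₁ ∧ τ₂.HasHolonomy h₂ ∧
    ∀ τ : S.Trajectory v, τ.IsPeriodic → τ₁.SameSides τ ∨ τ₂.SameSides τ

lemma Corr.hasTwoCylinders (h : Corr S₁ v₁ S₂ v₂ A) {w₁ w₂ : Plane}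
    (h2 : S₁.HasTwoCylinders v₁ w₁ w₂) : S₂.HasTwoCylinders v₂ (A w₁) (A w₂) := by
  obtain ⟨R, r1, r2, r3, r4⟩ := h
  obtain ⟨τ₁, τ₂, a, b, c⟩ := h2
  obtain ⟨σ₁, s1⟩ := r1 τ₁
  obtain ⟨σ₂, s2⟩ := r1 τ₂
  refine ⟨σ₁, σ₂, (r4 _ _ _ s1).1 a, (r4 _ _ _ s2).1 b, fun σ hσ => ?_⟩
  obtain ⟨τ, hτ⟩ := r2 σ
  have : τ.IsPeriodic := by
    obtain ⟨t, -, ht⟩ := hσ.exists_holonomy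
    rw [← A.apply_symm_apply (t • v₂), ← r4 _ _ _ hτ] at ht
    exact ht.isPeriodic
  rw [← r3 _ _ _ _ s1 hτ, ← r3 _ _ _ _ s2 hτ]
  exact c τ this

lemma Corr.isShortCylinderVector (h : Corr S₁ v₁ S₂ (A v₁) A) (hs : S₁.IsShortCylinderVector v₁) :
    S₂.IsShortCylinderVector (A v₁) := by
  obtain ⟨R, r1, r2, r3, r4⟩ := h
  obtain ⟨⟨τ, hτ⟩, hm⟩ := hs
  obtain ⟨σ, hσ⟩ := r1 τ
  refine ⟨⟨σ, (r4 _ _ _ hσ).1 hτ⟩, fun σ t h => ?_⟩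
  obtain ⟨τ, hτ⟩ := r2 σ
  rw [← map_smul, ← r4 _ _ _ hτ] at h
  exact hm τ t h

end Corr

/-- Cylinders are `SameSides` classes of periodic trajectories; the different holonomy vectors keep
the two classes apart. -/
lemma HasTwoCylinders.isCylinder {S : TranslationSurface ι n} (hn : 3 ≤ n) {v h₁ h₂ : Plane}
    (h : S.HasTwoCylinders v h₁ h₂) (hne : h₁ ≠ h₂) :
    ∃ short long : Set (S.Trajectory v), short ≠ long ∧ {C | S.IsCylinder v C} = {short, long} ∧
      (∀ τ ∈ short, τ.HasHolonomy h₁) ∧ ∀ τ ∈ long, τ.HasHolonomy h₂ := by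
  obtain ⟨τ₁, τ₂, a, b, c⟩ := h
  have hC : ∀ τ : S.Trajectory v, τ.IsPeriodic →
      {τ' | τ.SameCylinder τ'} = {τ' | τ.SameSides τ'} := by
    intro τ hτ
    ext τ'
    exact Trajectory.sameCylinder_iff hn hτ
  have hE : ∀ τ τ' : S.Trajectory v, τ.SameSides τ' →
      {σ | τ'.SameSides σ} = {σ | τ.SameSides σ} := by
    intro τ τ' h
    ext σ
    exact ⟨h.trans, h.symm.trans⟩
  refine ⟨{τ | τ₁.SameSides τ}, {τ | τ₂.SameSides τ}, fun he => ?_, ?_,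
    fun τ hτ => hτ.hasHolonomy hn a, fun τ hτ => hτ.hasHolonomy hn b⟩
  · have : τ₂ ∈ {τ | τ₁.SameSides τ} := by rw [he]; exact Trajectory.SameSides.refl _
    exact hne ((this.hasHolonomy hn a).unique b)
  · ext C
    constructor
    · rintro ⟨τ, hτ, rfl⟩
      rw [hC τ hτ]
      rcases c τ hτ with h | h
      · exact Or.inl (hE _ _ h)
      · exact Or.inr (hE _ _ h)
    · rintro (rfl | rfl)
      · exact ⟨τ₁, a.isPeriodic, (hC _ a.isPeriodic).symm⟩
      · exact ⟨τ₂, b.isPeriodic, (hC _ b.isPeriodic).symm⟩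

end TranslationSurface
namespace TranslationSurface

variable {ι : Type} {n : ℕ} [NeZero n] {ι' : Type} {n' : ℕ} [NeZero n']

/-! ### Affine maps between surfaces -/

section Affine

variable {S : TranslationSurface ι n} {S' : TranslationSurface ι' n'}

/-- The bijection `f` between the sides of two surfaces is induced by a map that restricts to a
translate of the linear map `A` on each polygon; the map reverses the sides if `flip` holds. -/
structure IsAffine (S : TranslationSurface ι n) (S' : TranslationSurface ι' n')
    (A : Plane ≃ₗ[ℝ] Plane) (f : ι × Fin n ≃ ι' × Fin n') (flip : Bool) : Prop where
  polygon : ∀ e e', (f e).1 = (f e').1 ↔ e.1 = e'.1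
  glue : ∀ e, f (S.glue e) = S'.glue (f e)
  point : ∀ e e' t t', e.1 = e'.1 →
    S'.point (f e) (bif flip then 1 - t else t) - S'.point (f e') (bif flip then 1 - t' else t') =
      A (S.point e t - S.point e' t')

lemma IsAffine.symm {A : Plane ≃ₗ[ℝ] Plane} {f : ι × Fin n ≃ ι' × Fin n'} {flip : Bool}
    (h : IsAffine S S' A f flip) : IsAffine S' S A.symm f.symm flip where
  polygon e e' := by rw [← h.polygon]; simp
  glue e := by rw [Equiv.symm_apply_eq, h.glue]; simp
  point e e' t t' he := by
    rw [LinearEquiv.eq_symm_apply, ← h.point]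
    · cases flip <;> simp
    · rw [← h.polygon]; simpa using he

lemma IsAffine.exists_image {A : Plane ≃ₗ[ℝ] Plane} {f : ι × Fin n ≃ ι' × Fin n'} {flip : Bool}
    (h : IsAffine S S' A f flip) {v : Plane} (τ : S.Trajectory v) :
    ∃ τ' : S'.Trajectory (A v), (∀ k, τ'.side k = f (τ.side k)) ∧
      (∀ k, τ'.pos k = bif flip then 1 - τ.pos k else τ.pos k) ∧ ∀ k, τ'.time k = τ.time k := by
  refine ⟨⟨fun k => f (τ.side k), fun k => bif flip then 1 - τ.pos k else τ.pos k, τ.time,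
    fun k => ?_, τ.time_pos, fun k => ?_, fun k => ?_, fun k => ?_⟩, fun _ => rfl, fun _ => rfl,
    fun _ => rfl⟩
  · have := τ.pos_mem k
    cases flip
    · exact this
    · exact ⟨by simpa using this.2, by simpa using this.1⟩
  · rw [← h.glue, h.polygon]
    exact τ.same_polygon k
  · rw [← h.glue]
    exact fun e => τ.side_ne k (f.injective e)
  · have h1 := h.point (τ.side (k + 1)) (S.glue (τ.side k)) (τ.pos (k + 1)) (1 - τ.pos k)
      (τ.same_polygon k).symm
    rw [τ.segment k, add_sub_cancel_left, map_smul, h.glue, sub_eq_iff_eq_add'] at h1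
    rw [h1]
    cases flip <;> rfl

theorem IsAffine.corr {A : Plane ≃ₗ[ℝ] Plane} {f : ι × Fin n ≃ ι' × Fin n'} {flip : Bool}
    (h : IsAffine S S' A f flip) (v : Plane) : Corr S v S' (A v) A := by
  refine ⟨fun τ τ' => (∀ k, τ'.side k = f (τ.side k)) ∧
      (∀ k, τ'.pos k = bif flip then 1 - τ.pos k else τ.pos k) ∧ ∀ k, τ'.time k = τ.time k,
    h.exists_image, fun τ' => ?_, ?_, ?_⟩
  · obtain ⟨τ, h1, h2, h3⟩ := h.symm.exists_image τ'
    -- The preimage has direction `A.symm (A v)`, which equals `v` only propositionally, so the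
    -- direction is generalized to `w` before substitution.
    have key : ∀ w, w = v → ∀ τ : S.Trajectory w, (∀ k, τ.side k = f.symm (τ'.side k)) →
        (∀ k, τ.pos k = bif flip then 1 - τ'.pos k else τ'.pos k) → (∀ k, τ.time k = τ'.time k) →
        ∃ τ : S.Trajectory v, (∀ k, τ'.side k = f (τ.side k)) ∧
          (∀ k, τ'.pos k = bif flip then 1 - τ.pos k else τ.pos k) ∧
          ∀ k, τ'.time k = τ.time k := by
      rintro w rfl τ h1 h2 h3
      refine ⟨τ, fun k => by simp [h1], fun k => ?_, fun k => (h3 k).symm⟩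
      rw [h2]
      cases flip <;> simp
    exact key _ (by simp) τ h1 h2 h3
  · rintro τ τ' σ σ' ⟨h1, -⟩ ⟨h1', -⟩
    simp only [Trajectory.SameSides, h1, h1', f.apply_eq_iff_eq]
  · rintro τ τ' w ⟨h1, h2, h3⟩
    have hc : ∀ M, τ.ClosesAfter M ↔ τ'.ClosesAfter M := by
      intro M
      simp only [Trajectory.ClosesAfter, h1, h2, f.apply_eq_iff_eq]
      cases flip <;> simp
    simp only [Trajectory.HasHolonomy, Trajectory.HasCombinatorialPeriod, hc, h3, ← map_smul]
    exact exists_congr fun N => and_congr_right fun _ => A.injective.eq_iff.symm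

/-- The surface with each polygon `i` replaced by its image under `A`, translated by `off i`. -/
def map (S : TranslationSurface ι n) (A : Plane ≃ₗ[ℝ] Plane)
    (hA : ∀ u w, 0 < cross u w → 0 < cross (A u) (A w)) (off : ι → Plane) :
    TranslationSurface ι n where
  vertex i k := A (S.vertex i k) + off i
  glue := S.glue
  convex i k j h1 h2 := by
    simp only [add_sub_add_right_eq_sub, ← map_sub]
    exact hA _ _ (S.convex i k j h1 h2)
  glue_glue := S.glue_glue
  glue_side e := by
    simp only [add_sub_add_right_eq_sub, ← map_sub, S.glue_side e, ← map_neg]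

lemma isAffine_map (S : TranslationSurface ι n) (A : Plane ≃ₗ[ℝ] Plane)
    (hA : ∀ u w, 0 < cross u w → 0 < cross (A u) (A w)) (off : ι → Plane) :
    IsAffine S (S.map A hA off) A (Equiv.refl _) false where
  polygon e e' := Iff.rfl
  glue e := rfl
  point e e' t t' he := by
    simp only [TranslationSurface.point, map, Equiv.refl_apply, he, cond_false, map_sub, map_add,
      map_smul]
    module

end Affine

/-! ### Subdivisions -/

/-- The bi-infinite sequence `j` runs through the integers with the property `P` in their order. -/
def Enumerates (P : ℤ → Prop) (j : ℤ → ℤ) : Prop :=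
  ∀ k, j k < j (k + 1) ∧ P (j k) ∧ ∀ i, j k < i → i < j (k + 1) → ¬P i

namespace Enumerates

variable {P : ℤ → Prop} {j : ℤ → ℤ}

lemma strictMono (h : Enumerates P j) : StrictMono j :=
  strictMono_int_of_lt_succ fun k => (h k).1

lemma exists_mem_Ioc (h : Enumerates P j) (i : ℤ) : ∃ k, j k < i ∧ i ≤ j (k + 1) := by
  have hup : ∀ m : ℕ, j 0 + m ≤ j m := by
    intro m
    induction m with
    | zero => simp
    | succ m ih => have := (h m).1; push_cast; omega
  have hdown : ∀ m : ℕ, j (-m) ≤ j 0 - m := by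
    intro m
    induction m with
    | zero => simp
    | succ m ih =>
      have := (h (-(m + 1 : ℕ))).1
      rw [show -((m + 1 : ℕ) : ℤ) + 1 = -m by push_cast; ring] at this
      push_cast at *
      omega
  obtain ⟨k, hk, hk'⟩ := Int.exists_least_of_bdd (P := fun k => i ≤ j k)
    ⟨-((j 0 - i).toNat + 1 : ℕ), fun z hz => by
      by_contra! hlt
      have h1 := h.strictMono hlt
      have h2 := hdown ((j 0 - i).toNat + 1)
      push_cast at *
      omega⟩
    ⟨((i - j 0).toNat : ℕ), by have := hup (i - j 0).toNat; omega⟩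
  refine ⟨k - 1, ?_, by simpa using hk⟩
  by_contra! hlt
  have := hk' _ hlt
  omega

lemma mem_Ioc_unique (h : Enumerates P j) {i k k' : ℤ} (h1 : j k < i) (h2 : i ≤ j (k + 1))
    (h1' : j k' < i) (h2' : i ≤ j (k' + 1)) : k = k' := by
  have a := h.strictMono.lt_iff_lt.1 (h1.trans_le h2')
  have b := h.strictMono.lt_iff_lt.1 (h1'.trans_le h2)
  omega

lemma exists_eq (h : Enumerates P j) {i : ℤ} (hi : P i) : ∃ k, j k = i := by
  obtain ⟨k, h1, h2⟩ := h.exists_mem_Ioc i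
  refine ⟨k + 1, ?_⟩
  by_contra hne
  exact (h k).2.2 i h1 (lt_of_le_of_ne h2 (Ne.symm hne)) hi

/-- Once aligned, neither enumeration can skip the next or the previous value of the other. -/
lemma eq_add (h : Enumerates P j) {j' : ℤ → ℤ} (h' : Enumerates P j') {a : ℤ} (ha : j 0 = j' a)
    (k : ℤ) : j k = j' (a + k) := by
  induction k using Int.induction_on with
  | zero => simpa using ha
  | succ i ih =>
    rw [← add_assoc]
    obtain ⟨a1, -, a3⟩ := h i
    obtain ⟨b1, -, b3⟩ := h' (a + i)
    rw [ih] at a1 a3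
    rcases lt_trichotomy (j (i + 1)) (j' (a + i + 1)) with hl | hl | hl
    · exact absurd (h _).2.1 (b3 _ a1 hl)
    · exact hl
    · exact absurd (h' _).2.1 (a3 _ b1 hl)
  | pred i ih =>
    obtain ⟨a1, -, a3⟩ := h (-i - 1)
    obtain ⟨b1, -, b3⟩ := h' (a + (-i - 1))
    rw [show -(i : ℤ) - 1 + 1 = -i by ring, ih] at a1 a3
    rw [show a + (-(i : ℤ) - 1) + 1 = a + -i by ring] at b1 b3
    rcases lt_trichotomy (j (-i - 1)) (j' (a + (-i - 1))) with hl | hl | hl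
    · exact absurd (h' _).2.1 (a3 _ hl b1)
    · exact hl
    · exact absurd (h _).2.1 (b3 _ hl a1)

end Enumerates

/-- The side `e` of a subdivision is a side of the subdivided surface. -/
def OuterSide (vtx : ι' × Fin n' → Fin n) (e : ι' × Fin n') : Prop :=
  vtx (e.1, e.2 + 1) = vtx e + 1

/-- The polygons of `T` subdivide those of `S`: the polygon `t` of `T` lies in the polygon `cell t`
of `S`, and its vertices are vertices of the latter. -/
structure IsSubdivision (T : TranslationSurface ι' n') (S : TranslationSurface ι n)
    (cell : ι' → ι) (vtx : ι' × Fin n' → Fin n) : Prop where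
  vertex : ∀ t l, T.vertex t l = S.vertex (cell t) (vtx (t, l))
  exists_outer : ∀ e, ∃ e', OuterSide vtx e' ∧ (cell e'.1, vtx e') = e
  outer_inj : ∀ e e', OuterSide vtx e → OuterSide vtx e' → (cell e.1, vtx e) = (cell e'.1, vtx e') →
    e = e'
  outer_glue : ∀ e, OuterSide vtx (T.glue e) ↔ OuterSide vtx e
  glue_outer : ∀ e, OuterSide vtx e → (cell (T.glue e).1, vtx (T.glue e)) = S.glue (cell e.1, vtx e)
  cell_inner : ∀ e, ¬OuterSide vtx e → cell (T.glue e).1 = cell e.1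
  glue_inner : ∀ e, ¬OuterSide vtx e → vtx ((T.glue e).1, (T.glue e).2 + 1) = vtx e
  inner_run : ∀ e₁ e₂ e₃ : ι' × Fin n', (T.glue e₁).1 = e₂.1 → T.glue e₁ ≠ e₂ →
    (T.glue e₂).1 = e₃.1 → T.glue e₂ ≠ e₃ →
    OuterSide vtx e₁ ∨ OuterSide vtx e₂ ∨ OuterSide vtx e₃

namespace IsSubdivision

variable {T : TranslationSurface ι' n'} {S : TranslationSurface ι n} {cell : ι' → ι}
  {vtx : ι' × Fin n' → Fin n} {v : Plane}

/-- The two small polygons at an inner side already lie next to each other in their common cell. -/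
lemma disp_inner (h : IsSubdivision T S cell vtx) {e : ι' × Fin n'} (he : ¬OuterSide vtx e) :
    T.disp e = 0 := by
  rw [disp, h.vertex, h.vertex, h.cell_inner e he, h.glue_inner e he, sub_self]

lemma disp_outer (h : IsSubdivision T S cell vtx) {e : ι' × Fin n'} (he : OuterSide vtx e) :
    T.disp e = S.disp (cell e.1, vtx e) := by
  have h1 : vtx ((T.glue e).1, (T.glue e).2 + 1) = vtx (T.glue e) + 1 := (h.outer_glue e).2 he
  rw [disp, h.vertex, h.vertex, h1, disp, ← h.glue_outer e he]

lemma point_outer (h : IsSubdivision T S cell vtx) {e : ι' × Fin n'} (he : OuterSide vtx e) (t : ℝ) :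
    T.point e t = S.point (cell e.1, vtx e) t := by
  have h1 : vtx (e.1, e.2 + 1) = vtx e + 1 := he
  rw [point, h.vertex, h.vertex, h1, point]

lemma ascends_outer (h : IsSubdivision T S cell vtx) {e : ι' × Fin n'} (he : OuterSide vtx e)
    {c : ℝ} : T.Ascends v c e.1 e.2 ↔ S.Ascends v c (cell e.1) (vtx e) := by
  have h1 : vtx (e.1, e.2 + 1) = vtx e + 1 := he
  rw [Ascends, h.vertex, h.vertex, h1, Ascends]

lemma descends_outer (h : IsSubdivision T S cell vtx) {e : ι' × Fin n'} (he : OuterSide vtx e)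
    {c : ℝ} : T.Descends v c e.1 e.2 ↔ S.Descends v c (cell e.1) (vtx e) := by
  have h1 : vtx (e.1, e.2 + 1) = vtx e + 1 := he
  rw [Descends, h.vertex, h.vertex, h1, Descends]

/-- The trajectory `τ` on `S` is the trajectory `τ'` on its subdivision, with the crossings of the
new sides omitted. -/
def Coarsens (cell : ι' → ι) (vtx : ι' × Fin n' → Fin n) (τ : S.Trajectory v)
    (τ' : T.Trajectory v) (j : ℤ → ℤ) : Prop :=
  Enumerates (fun i => OuterSide vtx (τ'.side i)) j ∧
    ∀ k, τ.side k = (cell (τ'.side (j k)).1, vtx (τ'.side (j k))) ∧ τ.pos k = τ'.pos (j k)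

lemma level_run (h : IsSubdivision T S cell vtx) (τ' : T.Trajectory v) (a i : ℤ) (hi : a ≤ i)
    (hin : ∀ i', a ≤ i' → i' < i → ¬OuterSide vtx (τ'.side i')) :
    τ'.level i = τ'.level a ∧ cell (τ'.side i).1 = cell (τ'.side a).1 := by
  induction i, hi using Int.leInduction with
  | base => exact ⟨rfl, rfl⟩
  | succ i hi ih =>
    obtain ⟨h1, h2⟩ := ih fun i' a b => hin i' a (by omega)
    have h3 := hin i hi (by omega)
    rw [τ'.level_succ, h.disp_inner h3, ← τ'.same_polygon, h.cell_inner _ h3, h1, h2]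
    simp [cross]

lemma Coarsens.level_eq (h : IsSubdivision T S cell vtx) {τ : S.Trajectory v} {τ' : T.Trajectory v}
    {j : ℤ → ℤ} (hj : Coarsens cell vtx τ τ' j) (k : ℤ) : τ.level k = τ'.level (j k) := by
  rw [Trajectory.level, Trajectory.level, (hj.2 k).1, (hj.2 k).2, h.point_outer (hj.1 k).2.1]

/-- A crossing of the subdivision lies on the segment of the coarse trajectory up to its next
crossing. -/
lemma Coarsens.level_eq_of_mem (h : IsSubdivision T S cell vtx) {τ : S.Trajectory v}
    {τ' : T.Trajectory v} {j : ℤ → ℤ} (hj : Coarsens cell vtx τ τ' j) {i k : ℤ} (h1 : j k < i)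
    (h2 : i ≤ j (k + 1)) :
    τ'.level i = τ.level (k + 1) ∧ cell (τ'.side i).1 = (τ.side (k + 1)).1 := by
  obtain ⟨-, ho, hin⟩ := hj.1 k
  obtain ⟨a, b⟩ := h.level_run τ' (j k + 1) i (by omega) fun i' a b => hin i' (by omega) (by omega)
  have hc := h.glue_outer _ ho
  rw [a, b, τ'.level_succ, τ.level_succ, hj.level_eq h, h.disp_outer ho, ← (hj.2 k).1,
    ← τ'.same_polygon, ← τ.same_polygon, (hj.2 k).1, ← hc]
  exact ⟨rfl, rfl⟩

/-- The coarse trajectory consists of the outer crossings. Between two of them level and cell do not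
change (`level_run`), so their sides and levels satisfy the hypotheses of `exists_of_levels`. -/
lemma exists_coarsens (hn : 3 ≤ n) (hn' : 3 ≤ n') (h : IsSubdivision T S cell vtx)
    (τ' : T.Trajectory v) : ∃ (τ : S.Trajectory v) (j : ℤ → ℤ), Coarsens cell vtx τ τ' j ∧
      (OuterSide vtx (τ'.side 0) → j 0 = 0) := by
  classical
  -- At least one of three consecutive crossings is outer, so the next and the previous outer
  -- crossing are at most three steps away.
  have run : ∀ i, OuterSide vtx (τ'.side i) ∨ OuterSide vtx (τ'.side (i + 1)) ∨
      OuterSide vtx (τ'.side (i + 1 + 1)) := fun i =>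
    h.inner_run _ _ _ (τ'.same_polygon _) (τ'.side_ne _) (τ'.same_polygon _) (τ'.side_ne _)
  let P : ℤ → Prop := fun i => OuterSide vtx (τ'.side i)
  have run' : ∀ i, P i ∨ P (i + 1) ∨ P (i + 1 + 1) := run
  obtain ⟨i₀, hi₀, hi₀'⟩ : ∃ i, P i ∧ (P 0 → i = 0) := by
    by_cases h0 : P 0
    · exact ⟨0, h0, fun _ => rfl⟩
    · rcases run' 0 with h1 | h1 | h1
      exacts [⟨_, h1, fun h => absurd h h0⟩, ⟨_, h1, fun h => absurd h h0⟩,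
        ⟨_, h1, fun h => absurd h h0⟩]
  obtain ⟨x, hx0, hx⟩ := exists_int_path (G := {i // P i})
    (fun x y => x.1 < y.1 ∧ ∀ i, x.1 < i → i < y.1 → ¬P i)
    (fun ⟨i, hi⟩ => by
      by_cases h1 : P (i + 1)
      · exact ⟨⟨i + 1, h1⟩, by simp, fun z a b => by simp only at a b; omega⟩
      by_cases h2 : P (i + 1 + 1)
      · refine ⟨⟨i + 1 + 1, h2⟩, by simp only; omega, fun z a b => ?_⟩
        obtain rfl : z = i + 1 := by simp only at a b; omega
        exact h1
      have h3 : P (i + 1 + 1 + 1) := by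
        have := run' (i + 1)
        tauto
      refine ⟨⟨i + 1 + 1 + 1, h3⟩, by simp only; omega, fun z a b => ?_⟩
      obtain rfl | rfl : z = i + 1 ∨ z = i + 1 + 1 := by simp only at a b; omega
      exacts [h1, h2])
    (fun ⟨i, hi⟩ => by
      by_cases h1 : P (i - 1)
      · exact ⟨⟨i - 1, h1⟩, by simp, fun z a b => by simp only at a b; omega⟩
      by_cases h2 : P (i - 2)
      · refine ⟨⟨i - 2, h2⟩, by simp only; omega, fun z a b => ?_⟩
        obtain rfl : z = i - 1 := by simp only at a b; omega
        exact h1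
      have h3 : P (i - 3) := by
        have := run' (i - 3)
        rw [show i - 3 + 1 = i - 2 by ring, show i - 2 + 1 = i - 1 by ring] at this
        tauto
      refine ⟨⟨i - 3, h3⟩, by simp only; omega, fun z a b => ?_⟩
      obtain rfl | rfl : z = i - 1 ∨ z = i - 2 := by simp only at a b; omega
      exacts [h1, h2]) ⟨i₀, hi₀⟩
  have hen : Enumerates P fun k => (x k).1 := fun k => ⟨(hx k).1, (x k).2, (hx k).2⟩
  obtain ⟨τ, ht, hl⟩ := Trajectory.exists_of_levels (S := S) (v := v) hn
    (fun k => (cell (τ'.side (x k)).1, vtx (τ'.side (x k)))) (fun k => τ'.level (x k))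
    (fun k => (h.ascends_outer (x k).2).1 (τ'.ascends hn' _))
    (fun k => by
      rw [← h.glue_outer _ (x k).2]
      obtain ⟨-, b⟩ := h.level_run τ' ((x k).1 + 1) (x (k + 1)) (by have := (hx k).1; omega)
        fun i' a b => (hx k).2 i' (by omega) (by omega)
      rw [b, τ'.same_polygon])
    (fun k => by
      obtain ⟨a, -⟩ := h.level_run τ' ((x k).1 + 1) (x (k + 1)) (by have := (hx k).1; omega)
        fun i' a b => (hx k).2 i' (by omega) (by omega)
      rw [a, τ'.level_succ, h.disp_outer (x k).2])
  refine ⟨τ, fun k => (x k).1, ⟨hen, fun k => ⟨ht k, ?_⟩⟩, fun h0 => ?_⟩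
  swap
  · beta_reduce
    rw [hx0]
    exact hi₀' h0
  have h1 := hl k
  have h2 := (τ.cross_edge_pos hn k).ne'
  rw [Trajectory.level, Trajectory.level, h.point_outer (x k).2, ← ht, point_eq, point_eq,
    cross_add_right, cross_add_right, cross_smul_right, cross_smul_right] at h1
  exact mul_right_cancel₀ h2 (add_left_cancel h1)

/-- The line of `τ` avoids the vertices of the large polygon, hence those of the small one. With
vertices on both sides of it, a turn around the small polygon passes the level once upwards and once
downwards. -/
lemma exists_descends_ascends (hn : 3 ≤ n) (h : IsSubdivision T S cell vtx) (τ : S.Trajectory v)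
    (k : ℤ) {t : ι'} (ht : cell t = (τ.side k).1) {a b : Fin n'}
    (ha : cross v (T.vertex t a) < τ.level k) (hb : τ.level k < cross v (T.vertex t b)) :
    (∃ l, T.Descends v (τ.level k) t l) ∧ ∃ l, T.Ascends v (τ.level k) t l := by
  have hne : ∀ l, cross v (T.vertex t l) ≠ τ.level k := by
    intro l
    rw [h.vertex, ht]
    obtain ⟨k, rfl⟩ : ∃ m, k = m + 1 := ⟨k - 1, by ring⟩
    refine (τ.ascends hn (k + 1)).vertex_ne hn (k := (S.glue (τ.side k)).2) ?_ _
    rw [← τ.same_polygon]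
    exact τ.descends_glue hn k
  refine ⟨?_, exists_lt_and_lt_add_one hne ha hb⟩
  obtain ⟨l, h1, h2⟩ := exists_lt_and_lt_add_one (f := fun l => -cross v (T.vertex t l))
    (c := -τ.level k) (fun l h => hne l (neg_injective h)) (neg_lt_neg hb) (neg_lt_neg ha)
  exact ⟨l, neg_lt_neg_iff.1 h2, neg_lt_neg_iff.1 h1⟩

/-- A state is a pair of a coarse index and a fine side in the corresponding cell that ascends at
the level of `τ`. Each state has a successor and a predecessor, so a bi-infinite path exists without
any count of the inner crossings. -/
lemma exists_refinement (hn : 3 ≤ n) (hn' : 3 ≤ n') (h : IsSubdivision T S cell vtx)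
    (τ : S.Trajectory v) : ∃ τ' : T.Trajectory v, OuterSide vtx (τ'.side 0) ∧
      (cell (τ'.side 0).1, vtx (τ'.side 0)) = τ.side 0 ∧ τ'.level 0 = τ.level 0 := by
  let Q : ℤ × ι' × Fin n' → Prop := fun x =>
    cell x.2.1 = (τ.side x.1).1 ∧ T.Ascends v (τ.level x.1) x.2.1 x.2.2
  let r : ℤ × ι' × Fin n' → ℤ × ι' × Fin n' → Prop := fun x y =>
    (T.glue x.2).1 = y.2.1 ∧ (OuterSide vtx x.2 ∧ y.1 = x.1 + 1 ∨ ¬OuterSide vtx x.2 ∧ y.1 = x.1)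
  have hout : ∀ x, Q x → OuterSide vtx x.2 → (cell x.2.1, vtx x.2) = τ.side x.1 := by
    intro x hx ho
    have h1 := (h.ascends_outer ho).1 hx.2
    rw [hx.1] at h1
    exact Prod.ext hx.1 (h1.unique hn (τ.ascends hn _))
  have hlev : ∀ x y, Q x → r x y → τ.level y.1 = τ.level x.1 - cross v (T.disp x.2) := by
    rintro x y hx ⟨-, ⟨ho, hy⟩ | ⟨ho, hy⟩⟩
    · rw [hy, τ.level_succ, h.disp_outer ho, hout x hx ho]
    · rw [hy, h.disp_inner ho]; simp [cross]
  obtain ⟨e₀, ho, he₀⟩ := h.exists_outer (τ.side 0)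
  obtain ⟨x, hx0, hx⟩ := exists_int_path (G := {x // Q x}) (fun x y => r x y)
    (by
      rintro ⟨⟨k, e⟩, hq⟩
      obtain ⟨k', hk'⟩ : ∃ k', OuterSide vtx e ∧ k' = k + 1 ∨ ¬OuterSide vtx e ∧ k' = k := by
        by_cases he : OuterSide vtx e <;> simp [he]
      have hc : cell (T.glue e).1 = (τ.side k').1 := by
        rcases hk' with ⟨ho, rfl⟩ | ⟨ho, rfl⟩
        · have h1 := h.glue_outer _ ho
          rw [hout _ hq ho] at h1
          rw [← τ.same_polygon, ← h1]
        · rw [h.cell_inner _ ho]; exact hq.1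
      have hd := hq.2.descends_glue
      rw [← hlev (k, e) (k', ((T.glue e).1, 0)) hq ⟨rfl, hk'⟩] at hd
      obtain ⟨-, l, hl⟩ := h.exists_descends_ascends hn τ k' hc hd.1 hd.2
      exact ⟨⟨(k', ((T.glue e).1, l)), hc, hl⟩, rfl, hk'⟩)
    (by
      rintro ⟨⟨k, e⟩, hq⟩
      obtain ⟨⟨l, hl⟩, -⟩ := h.exists_descends_ascends hn τ k hq.1 hq.2.1 hq.2.2
      have ha := Descends.ascends_glue (e := (e.1, l)) hl
      by_cases ho : OuterSide vtx (e.1, l)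
      · have h1 := (h.descends_outer ho).1 hl
        simp only [hq.1] at h1
        have h2 := τ.descends_glue hn (k - 1)
        rw [τ.same_polygon] at h2
        simp only [sub_add_cancel] at h2
        have h3 : (cell e.1, vtx (e.1, l)) = S.glue (τ.side (k - 1)) :=
          Prod.ext (by rw [hq.1, τ.same_polygon]; simp) (h1.unique hn h2)
        have h4 := h.glue_outer _ ho
        rw [h3, S.glue_glue] at h4
        refine ⟨⟨(k - 1, T.glue (e.1, l)), by rw [← h4], ?_⟩, by simp [T.glue_glue],
          Or.inl ⟨(h.outer_glue _).2 ho, by simp⟩⟩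
        have h5 : τ.level k - cross v (T.disp (e.1, l)) = τ.level (k - 1) := by
          have := τ.level_succ (k - 1)
          rw [sub_add_cancel] at this
          rw [h.disp_outer ho, h3, disp_glue, cross_neg_right, this]
          ring
        exact h5 ▸ ha
      · refine ⟨⟨(k, T.glue (e.1, l)), by rw [h.cell_inner _ ho]; exact hq.1, ?_⟩,
          by simp [T.glue_glue], Or.inr ⟨fun h1 => ho ((h.outer_glue _).1 h1), rfl⟩⟩
        rw [h.disp_inner ho] at ha
        simpa [cross] using ha)
    ⟨(0, e₀), by rw [← he₀], by
      rw [h.ascends_outer ho]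
      have := τ.ascends hn 0
      rwa [← he₀] at this⟩
  obtain ⟨τ', ht, hl⟩ := Trajectory.exists_of_levels (S := T) (v := v) hn' (fun i => (x i).1.2)
    (fun i => τ.level (x i).1.1) (fun i => (x i).2.2) (fun i => (hx i).1)
    (fun i => hlev _ _ (x i).2 (hx i))
  refine ⟨τ', ?_, ?_, ?_⟩
  · rw [ht, hx0]; exact ho
  · rw [ht, hx0]; exact he₀
  · rw [hl, hx0]

lemma Coarsens.shift {τ : S.Trajectory v} {τ' : T.Trajectory v} {j : ℤ → ℤ}
    (hj : Coarsens cell vtx τ τ' j) (m : ℤ) :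
    Coarsens cell vtx (τ.shift m) τ' fun k => j (k + m) := by
  refine ⟨fun k => ?_, fun k => hj.2 _⟩
  beta_reduce
  rw [add_right_comm]
  exact hj.1 _

lemma Coarsens.sameSides_of_fine {τ σ : S.Trajectory v} {τ' σ' : T.Trajectory v} {j j' : ℤ → ℤ}
    (hj : Coarsens cell vtx τ τ' j) (hj' : Coarsens cell vtx σ σ' j') (hs : τ'.SameSides σ') :
    τ.SameSides σ := by
  obtain ⟨m, hm⟩ := hs
  have h1 : Enumerates (fun i => OuterSide vtx (σ'.side i)) fun k => j k + m := by
    intro k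
    obtain ⟨a, b, c⟩ := hj.1 k
    beta_reduce at b c ⊢
    refine ⟨by omega, by rw [← hm]; exact b, fun i h1 h2 => ?_⟩
    have := c (i - m) (by omega) (by omega)
    rwa [hm, sub_add_cancel] at this
  obtain ⟨a, ha⟩ := hj'.1.exists_eq (h1 0).2.1
  refine ⟨a, fun k => ?_⟩
  have h2 := h1.eq_add hj'.1 ha.symm k
  rw [(hj.2 k).1, hm, h2, (hj'.2 _).1, add_comm]

/-- A fine vertex is a coarse vertex, so none separates `τ` from `σ`. The fine sides of `τ'` can
therefore be crossed at the levels of `σ`; the resulting trajectory `σ₂` shares a crossing with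
`σ'`. -/
lemma Coarsens.sameSides_of_coarse (hn : 3 ≤ n) (hn' : 3 ≤ n') (h : IsSubdivision T S cell vtx)
    {τ σ : S.Trajectory v} {τ' σ' : T.Trajectory v} {j j' : ℤ → ℤ}
    (hj : Coarsens cell vtx τ τ' j) (hj' : Coarsens cell vtx σ σ' j')
    (hs : ∀ k, τ.side k = σ.side k) : τ'.SameSides σ' := by
  -- no vertex of a polygon lies between the segments of `τ` and `σ` in it
  have sep : ∀ k p, cross v (S.vertex (τ.side k).1 p) < τ.level k ↔
      cross v (S.vertex (τ.side k).1 p) < σ.level k := by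
    intro k p
    obtain ⟨k, rfl⟩ : ∃ m, k = m + 1 := ⟨k - 1, by ring⟩
    have a1 := τ.ascends hn (k + 1)
    have a2 := σ.ascends hn (k + 1)
    have b1 := τ.descends_glue hn k
    have b2 := σ.descends_glue hn k
    have hp := τ.same_polygon k
    rw [← hs] at a2 b2
    rw [hp] at b1 b2
    constructor <;> intro hlt <;> by_contra! hle <;>
    exact Ascends.vertex_ne hn (S := S) (v := v) (c := cross v (S.vertex (τ.side (k + 1)).1 p))
      (k' := (τ.side (k + 1)).2) (k := (S.glue (τ.side k)).2)
      ⟨by linarith [a1.1, a2.1], by linarith [a1.2, a2.2]⟩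
      ⟨by linarith [b1.1, b2.1], by linarith [b1.2, b2.2]⟩ p rfl
  have sep' : ∀ k p, τ.level k < cross v (S.vertex (τ.side k).1 p) →
      σ.level k < cross v (S.vertex (τ.side k).1 p) := by
    intro k p hlt
    refine lt_of_le_of_ne (not_lt.1 fun h' => ?_) fun h' => ?_
    · exact absurd ((sep k p).2 h') (not_lt.2 hlt.le)
    · obtain ⟨k, rfl⟩ : ∃ m, k = m + 1 := ⟨k - 1, by ring⟩
      have a := σ.ascends hn (k + 1)
      have b := σ.descends_glue hn k
      rw [σ.same_polygon] at b
      rw [hs] at h'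
      exact a.vertex_ne hn b p h'.symm
  -- `K i` is the coarse crossing before the fine crossing `i`. The interval is closed on the right:
  -- an outer crossing belongs to the segment that it ends, so `K (j 0) = -1` below.
  choose K hK1 hK2 using hj.1.exists_mem_Ioc
  have hlev : ∀ i, τ'.level i = τ.level (K i + 1) := fun i =>
    (hj.level_eq_of_mem h (hK1 i) (hK2 i)).1
  have hcell : ∀ i, cell (τ'.side i).1 = (τ.side (K i + 1)).1 := fun i =>
    (hj.level_eq_of_mem h (hK1 i) (hK2 i)).2
  have hKo : ∀ i, OuterSide vtx (τ'.side i) → j (K i + 1) = i := by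
    intro i ho
    by_contra hne
    exact (hj.1 (K i)).2.2 i (hK1 i) (lt_of_le_of_ne (hK2 i) (Ne.symm hne)) ho
  obtain ⟨σ₂, s1, s2⟩ := Trajectory.exists_of_levels (S := T) (v := v) hn' τ'.side
    (fun i => σ.level (K i + 1))
    (fun i => by
      have := τ'.ascends hn' i
      rw [hlev i, Ascends, h.vertex, h.vertex, hcell] at this
      rw [Ascends, h.vertex, h.vertex, hcell]
      exact ⟨(sep _ _).1 this.1, sep' _ _ this.2⟩)
    τ'.same_polygon
    (fun i => by
      by_cases ho : OuterSide vtx (τ'.side i)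
      · have h1 := hKo i ho
        have h2 := (hj.1 (K i + 1)).1
        have h3 : K (i + 1) = K i + 1 := hj.1.mem_Ioc_unique (hK1 _) (hK2 _) (by omega) (by omega)
        rw [h3, σ.level_succ, h.disp_outer ho, ← hs, (hj.2 _).1, h1]
      · have h1 : j (K i + 1) ≠ i := fun h1 => ho (by rw [← h1]; exact (hj.1 _).2.1)
        have h2 := hK2 i
        have h3 : K (i + 1) = K i := hj.1.mem_Ioc_unique (hK1 _) (hK2 _)
          (by have := hK1 i; omega) (by omega)
        rw [h3, h.disp_inner ho]
        simp [cross])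
  have e1 : σ₂.side (j 0) = σ'.side (j' 0) := by
    rw [s1]
    refine h.outer_inj _ _ (hj.1 0).2.1 (hj'.1 0).2.1 ?_
    rw [← (hj.2 0).1, ← (hj'.2 0).1, hs]
  have e2 : σ₂.level (j 0) = σ'.level (j' 0) := by
    have h1 : K (j 0) = -1 := by
      have := hKo (j 0) (hj.1 0).2.1
      have := hj.1.strictMono.injective this
      omega
    rw [s2, ← hj'.level_eq h, h1]
    rfl
  exact Trajectory.SameSides.trans ⟨0, fun k => by simp [s1]⟩
    (Trajectory.sameSides_of_crossing_eq hn' e1 (Trajectory.pos_eq_of_level_eq hn' e1 e2))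

lemma Coarsens.closesAfter_fine (hn' : 3 ≤ n') (h : IsSubdivision T S cell vtx)
    {τ : S.Trajectory v} {τ' : T.Trajectory v} {j : ℤ → ℤ} (hj : Coarsens cell vtx τ τ' j) {N : ℕ}
    (hN : τ.ClosesAfter N) : τ'.ClosesAfter (j N - j 0).toNat := by
  have hlt : j 0 < j N := hj.1.strictMono (by exact_mod_cast hN.1)
  have hc := hN.2 0
  rw [zero_add, (hj.2 _).1, (hj.2 _).1, (hj.2 _).2, (hj.2 _).2] at hc
  have e : j 0 + (j N - j 0).toNat = j N := by omega
  refine Trajectory.closesAfter_of_crossing_eq hn' (k := j 0) (by omega) ?_ ?_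
  · rw [e]
    exact h.outer_inj _ _ (hj.1 _).2.1 (hj.1 _).2.1 hc.1
  · rw [e, hc.2]

lemma Coarsens.closesAfter_coarse (hn : 3 ≤ n) {τ : S.Trajectory v} {τ' : T.Trajectory v}
    {j : ℤ → ℤ} (hj : Coarsens cell vtx τ τ' j) {M : ℕ} (hM : τ'.ClosesAfter M) :
    ∃ N : ℕ, τ.ClosesAfter N ∧ j N = j 0 + M := by
  have h0 := hM.2 (j 0)
  obtain ⟨N, hN⟩ := hj.1.exists_eq (i := j 0 + M) (by rw [h0.1]; exact (hj.1 0).2.1)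
  have hpos : 0 < N := by
    rw [← hj.1.strictMono.lt_iff_lt, hN]
    have := hM.1
    omega
  lift N to ℕ using hpos.le
  refine ⟨N, Trajectory.closesAfter_of_crossing_eq hn (k := 0) (by omega) ?_ ?_, hN⟩
  · rw [zero_add, (hj.2 _).1, (hj.2 _).1, hN, h0.1]
  · rw [zero_add, (hj.2 _).2, (hj.2 _).2, hN, h0.2]

/-- In each block of fine crossings that starts with an outer one, only that first crossing
contributes. -/
lemma Coarsens.sum_disp (h : IsSubdivision T S cell vtx) {τ : S.Trajectory v}
    {τ' : T.Trajectory v} {j : ℤ → ℤ} (hj : Coarsens cell vtx τ τ' j) (N : ℕ) :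
    ∑ i ∈ Finset.range (j N - j 0).toNat, T.disp (τ'.side (i + j 0)) =
      ∑ k ∈ Finset.range N, S.disp (τ.side k) := by
  induction N with
  | zero => simp
  | succ N ih =>
    have h1 : j 0 ≤ j N := hj.1.strictMono.monotone (by positivity)
    obtain ⟨h2, ho, h3⟩ := hj.1 N
    have e : (j ((N + 1 : ℕ) : ℤ) - j 0).toNat = (j N - j 0).toNat + (j (N + 1) - j N).toNat := by
      push_cast
      omega
    rw [e, Finset.sum_range_add, ih, Finset.sum_range_succ]
    congr 1
    rw [(hj.2 N).1, ← h.disp_outer ho, Finset.sum_eq_single 0]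
    · congr 2
      omega
    · intro i hi hne
      refine h.disp_inner (h3 _ ?_ ?_) <;> rw [Finset.mem_range] at hi <;> push_cast <;> omega
    · intro h0
      exact absurd (Finset.mem_range.2 (by omega)) h0

lemma Coarsens.hasHolonomy_iff (hn : 3 ≤ n) (hn' : 3 ≤ n') (h : IsSubdivision T S cell vtx)
    {τ : S.Trajectory v} {τ' : T.Trajectory v} {j : ℤ → ℤ} (hj : Coarsens cell vtx τ τ' j)
    (w : Plane) : τ.HasHolonomy w ↔ τ'.HasHolonomy w := by
  have key : ∀ w, τ.HasHolonomy w → τ'.HasHolonomy w := by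
    intro w hw
    rw [Trajectory.hasHolonomy_iff] at hw ⊢
    obtain ⟨N, hN, rfl⟩ := hw
    have hc := hj.closesAfter_fine hn' h hN.1
    refine ⟨(j N - j 0).toNat, ⟨hc, fun M hM => ?_⟩, ?_⟩
    · obtain ⟨N', h1, h2⟩ := hj.closesAfter_coarse hn hM
      have h3 := hj.1.strictMono.monotone (Int.ofNat_le.2 (hN.2 h1))
      omega
    · rw [← hj.sum_disp h N]
      exact sum_range_add_int_eq (fun i => T.disp (τ'.side i)) (fun i => by rw [(hc.2 i).1]) _
  -- For the converse, periodicity of `τ'` gives `τ` some holonomy vector, which by `key` is also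
  -- that of `τ'`, hence equals `w`.
  refine ⟨key w, fun hw => ?_⟩
  obtain ⟨M, hM⟩ := hw.isPeriodic
  obtain ⟨N, hN, -⟩ := hj.closesAfter_coarse hn hM
  obtain ⟨t, -, ht⟩ := Trajectory.IsPeriodic.exists_holonomy ⟨N, hN⟩
  rwa [hw.unique (key _ ht)]

theorem corr (hn : 3 ≤ n) (hn' : 3 ≤ n') (h : IsSubdivision T S cell vtx) (v : Plane) :
    Corr S v T v (LinearEquiv.refl ℝ Plane) := by
  refine ⟨fun τ τ' => ∃ j, Coarsens cell vtx τ τ' j, fun τ => ?_, fun τ' => ?_, ?_, ?_⟩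
  · obtain ⟨τ', h1, h2, h3⟩ := h.exists_refinement hn hn' τ
    -- The coarsening of the refinement has the crossing number `0` of `τ`, hence is `τ` itself.
    obtain ⟨σ, j, hj, hj0⟩ := h.exists_coarsens hn hn' τ'
    have e1 : σ.side 0 = τ.side 0 := by rw [(hj.2 0).1, hj0 h1, h2]
    have e2 : σ.level 0 = τ.level 0 := by rw [hj.level_eq h, hj0 h1, h3]
    have e3 := Trajectory.eq_of_crossing_eq hn e1 (Trajectory.pos_eq_of_level_eq hn e1 e2)
    simp only [zero_add] at e3
    exact ⟨τ', j, hj.1, fun k => by rw [← (e3 k).1, ← (e3 k).2]; exact hj.2 k⟩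
  · obtain ⟨σ, j, hj, -⟩ := h.exists_coarsens hn hn' τ'
    exact ⟨σ, j, hj⟩
  · rintro τ τ' σ σ' ⟨j, hj⟩ ⟨j', hj'⟩
    refine ⟨fun ⟨m, hm⟩ => ?_, hj.sameSides_of_fine hj'⟩
    exact hj.sameSides_of_coarse hn hn' h (hj'.shift m) hm
  · rintro τ τ' w ⟨j, hj⟩
    exact hj.hasHolonomy_iff hn hn' h w

end IsSubdivision
end TranslationSurface

/-! ### The shear and the regular pentagon in golden coordinates -/

open Real (goldenRatio)

lemma goldenRatio_inv : goldenRatio⁻¹ = goldenRatio - 1 := by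
  rw [Real.inv_goldenRatio, ← Real.one_sub_goldenRatio]; ring

/-- The linear automorphism of the plane with the matrix `!![a, b; c, d]`. -/
def linEquiv (a b c d : ℝ) (h : a * d - b * c ≠ 0) : Plane ≃ₗ[ℝ] Plane where
  toFun v := ![a * v 0 + b * v 1, c * v 0 + d * v 1]
  invFun v := ![(d * v 0 - b * v 1) / (a * d - b * c), (a * v 1 - c * v 0) / (a * d - b * c)]
  map_add' v w := by ext l; fin_cases l <;> simp <;> ring
  map_smul' t v := by ext l; fin_cases l <;> simp <;> ring
  left_inv v := by ext l; fin_cases l <;> simp [div_eq_iff h] <;> ring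
  right_inv v := by
    ext l; fin_cases l <;> simp [← mul_div_assoc, ← add_div, div_eq_iff h] <;> ring

lemma linEquiv_apply {a b c d : ℝ} (h : a * d - b * c ≠ 0) (v : Plane) :
    linEquiv a b c d h v = ![a * v 0 + b * v 1, c * v 0 + d * v 1] := rfl

lemma cos_pi_div_five_eq : Real.cos (Real.pi / 5) = goldenRatio / 2 := by
  rw [Real.cos_pi_div_five, goldenRatio]; ring

lemma sin_pi_div_five_pos : 0 < Real.sin (Real.pi / 5) :=
  Real.sin_pos_of_pos_of_lt_pi (by positivity) (by linarith [Real.pi_pos])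

lemma sin_pi_div_five_sq : Real.sin (Real.pi / 5) ^ 2 = (3 - goldenRatio) / 4 := by
  have h := Real.sin_sq_add_cos_sq (Real.pi / 5)
  rw [cos_pi_div_five_eq] at h
  linarith [Real.goldenRatio_sq]

/-- The map `shear` as a linear automorphism. -/
def shearEquiv : Plane ≃ₗ[ℝ] Plane :=
  linEquiv 1 (goldenRatio / 2) 0 (Real.sin (Real.pi / 5))
    (by simpa using sin_pi_div_five_pos.ne')

lemma shearEquiv_apply (v : Plane) : shearEquiv v = shear v := by
  rw [shear, cos_pi_div_five_eq]
  ext l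
  fin_cases l <;> simp [shearEquiv, linEquiv_apply, Matrix.mulVec, dotProduct, Fin.sum_univ_two]

lemma cross_shearEquiv (u w : Plane) :
    cross (shearEquiv u) (shearEquiv w) = Real.sin (Real.pi / 5) * cross u w := by
  simp only [shearEquiv, linEquiv_apply, cross, Matrix.cons_val_zero, Matrix.cons_val_one]
  ring

lemma cross_shearEquiv_pos (u w : Plane) (h : 0 < cross u w) :
    0 < cross (shearEquiv u) (shearEquiv w) := by
  rw [cross_shearEquiv]
  exact mul_pos sin_pi_div_five_pos h

/-- The preimages under `shear` of the vertices of the regular pentagon. -/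
def shearedPentagon : Fin 5 → Plane :=
  ![![-(goldenRatio + 2) / 5, (4 * goldenRatio - 2) / 5],
    ![-(goldenRatio + 2) / 5, (3 - goldenRatio) / 5],
    ![(3 - goldenRatio) / 5, -(goldenRatio + 2) / 5],
    ![(4 * goldenRatio - 2) / 5, -(goldenRatio + 2) / 5],
    ![(3 - goldenRatio) / 5, (3 - goldenRatio) / 5]]

lemma pentagonVertex_eq_shear (k : Fin 5) :
    pentagonVertex k = shearEquiv (shearedPentagon k) := by
  have hC := cos_pi_div_five_eq
  have hS := sin_pi_div_five_pos
  have hS2 := sin_pi_div_five_sq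
  have hg := Real.goldenRatio_sq
  have hg0 := Real.goldenRatio_pos
  have s1 : Real.sin (2 * Real.pi / 5) = Real.sin (Real.pi / 5) * goldenRatio := by
    rw [show 2 * Real.pi / 5 = 2 * (Real.pi / 5) by ring, Real.sin_two_mul, hC]; ring
  have c1 : Real.cos (2 * Real.pi / 5) = (goldenRatio - 1) / 2 := by
    rw [show 2 * Real.pi / 5 = 2 * (Real.pi / 5) by ring, Real.cos_two_mul, hC]; linarith
  have s2 : Real.sin (2 * Real.pi * 2 / 5) = Real.sin (Real.pi / 5) := by
    rw [← Real.sin_pi_sub]; ring_nf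
  have c2 : Real.cos (2 * Real.pi * 2 / 5) = -(goldenRatio / 2) := by
    rw [← hC, ← Real.cos_pi_sub]; ring_nf
  have s3 : Real.sin (2 * Real.pi * 3 / 5) = -Real.sin (Real.pi / 5) := by
    rw [← s2, ← Real.sin_two_pi_sub]; ring_nf
  have c3 : Real.cos (2 * Real.pi * 3 / 5) = -(goldenRatio / 2) := by
    rw [← c2, ← Real.cos_two_pi_sub]; ring_nf
  have s4 : Real.sin (2 * Real.pi * 4 / 5) = -(Real.sin (Real.pi / 5) * goldenRatio) := by
    rw [← s1, ← Real.sin_two_pi_sub]; ring_nf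
  have c4 : Real.cos (2 * Real.pi * 4 / 5) = (goldenRatio - 1) / 2 := by
    rw [← c1, ← Real.cos_two_pi_sub]; ring_nf
  -- As sin²(π/5) = (3 - φ)/4, the circumradius is sin(π/5) times an element of ℚ(φ). So abscissas
  -- lie in ℚ(φ) and ordinates in sin(π/5)·ℚ(φ).
  have hr : (2 * Real.sin (2 * Real.pi / 5))⁻¹ =
      Real.sin (Real.pi / 5) * (4 * goldenRatio - 2) / 5 := by
    rw [s1]
    refine inv_eq_of_mul_eq_one_right ?_
    linear_combination (4 * goldenRatio * (2 * goldenRatio - 1) / 5) * hS2 +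
      (5 - 2 * goldenRatio) / 5 * hg
  have hx : Real.sin (Real.pi / 5) * (4 * goldenRatio - 2) / 5 * Real.sin (Real.pi / 5) =
      (goldenRatio - 1) / 2 := by
    linear_combination (4 * goldenRatio - 2) / 5 * hS2 - hg / 5
  rw [pentagonVertex, hr, shearEquiv, linEquiv_apply, shearedPentagon]
  generalize Real.sin (Real.pi / 5) = s at *
  generalize goldenRatio = g at *
  fin_cases k <;> ext l <;> fin_cases l <;>
    simp [s1, c1, s2, c2, s3, c3, s4, c4]
  · linear_combination (-2 / 5 : ℝ) * hg
  · ring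
  · linear_combination (-g) * hx - (2 / 5 : ℝ) * hg
  · linear_combination (2 / 5 * s) * hg
  · linear_combination hg / 10 - hx
  · linear_combination (-2 / 5 * s) * hg
  · linear_combination hg / 10 + hx
  · linear_combination (-2 / 5 * s) * hg
  · linear_combination g * hx + (3 / 5 : ℝ) * hg
  · linear_combination (2 / 5 * s) * hg

/-! ### The common triangulation of the golden L and the double pentagon -/

/-- The vertices of the pieces of the L that span the triangles: the triangle `(i, true)` is the
lower left half and `(i, false)` the upper right half of the piece `i`. -/
def halfVertex (e : (Fin 3 × Bool) × Fin 3) : Fin 4 :=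
  (bif e.1.2 then ![0, 1, 3] else ![2, 3, 1] : Fin 3 → Fin 4) e.2

def triangulationGlue (e : (Fin 3 × Bool) × Fin 3) : (Fin 3 × Bool) × Fin 3 :=
  ((![above e.1.1, e.1.1, besides e.1.1] e.2, !e.1.2), e.2)

/-- The golden L with its three pieces cut along the descending diagonals. -/
def triangulatedL : TranslationSurface (Fin 3 × Bool) 3 where
  vertex t l := goldenLVertex t.1 (halfVertex (t, l))
  glue := triangulationGlue
  convex := by
    have h := inv_pos.2 Real.goldenRatio_pos
    simp only [goldenLVertex]
    generalize goldenRatio⁻¹ = g at *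
    rintro ⟨i, b⟩ k j h1 h2
    fin_cases i <;> cases b <;> fin_cases k <;> fin_cases j <;>
      simp [rectVertex, cross, halfVertex] at h1 h2 ⊢ <;> exact h
  glue_glue := by decide
  glue_side := by
    rintro ⟨⟨i, b⟩, k⟩
    fin_cases i <;> cases b <;> fin_cases k <;> ext l <;> fin_cases l <;>
      simp [triangulationGlue, goldenLVertex, rectVertex, above, besides, halfVertex]

open TranslationSurface

instance {ι' : Type} {n n' : ℕ} [NeZero n] [NeZero n'] (vtx : ι' × Fin n' → Fin n)
    (e : ι' × Fin n') : Decidable (OuterSide vtx e) :=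
  inferInstanceAs (Decidable (_ = _))

lemma isSubdivision_goldenL :
    IsSubdivision triangulatedL goldenL (fun t => t.1) halfVertex where
  vertex t l := rfl
  exists_outer := by decide
  outer_inj := by decide
  outer_glue := by
    change ∀ e, OuterSide _ (triangulationGlue e) ↔ _
    decide
  glue_outer := by
    change ∀ e, OuterSide _ e → ((triangulationGlue e).1.1, halfVertex (triangulationGlue e)) =
      goldenLGlue _
    decide
  cell_inner := by
    change ∀ e, ¬OuterSide _ e → (triangulationGlue e).1.1 = _
    decide
  glue_inner := by
    change ∀ e, ¬OuterSide _ e →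
      halfVertex ((triangulationGlue e).1, (triangulationGlue e).2 + 1) = _
    decide
  inner_run := by
    -- The triangles of the second and third side are determined by the first side, so the
    -- enumeration runs over one side and two indices only.
    have key : ∀ e k k', triangulationGlue e ≠ ((triangulationGlue e).1, k) →
        triangulationGlue ((triangulationGlue e).1, k) ≠
          ((triangulationGlue ((triangulationGlue e).1, k)).1, k') →
        OuterSide halfVertex e ∨ OuterSide halfVertex ((triangulationGlue e).1, k) ∨
        OuterSide halfVertex ((triangulationGlue ((triangulationGlue e).1, k)).1, k') := by
      decide
    rintro e ⟨t, k⟩ ⟨t', k'⟩ rfl h1 rfl h2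
    exact key e k k' h1 h2

/-- The vertices of the pentagons that span the triangles. -/
def pentagonHalfVertex (e : (Fin 3 × Bool) × Fin 3) : Fin 5 :=
  (![![4, 1, 2], ![2, 3, 4], ![1, 4, 0]] : Fin 3 → Fin 3 → Fin 5) e.1.1 e.2

/-- The pentagon that contains a triangle. -/
def pentagonOf (t : Fin 3 × Bool) : Bool := if t.1 = 0 then !t.2 else t.2

/-- The translations that fit the triangles together to two pentagons. -/
def pentagonOffset (t : Fin 3 × Bool) : Plane :=
  bif pentagonOf t then shearedPentagon 2 - ![1, 0]
  else (![-shearedPentagon 4, -shearedPentagon 2 - ![goldenRatio, 1],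
    -shearedPentagon 1 - ![1, goldenRatio]] : Fin 3 → Plane) t.1

/-- The image of the triangulated golden L, with the triangles placed in the double pentagon. -/
def triangulatedPentagons : TranslationSurface (Fin 3 × Bool) 3 :=
  triangulatedL.map shearEquiv cross_shearEquiv_pos fun t => shearEquiv (pentagonOffset t)

lemma triangulatedPentagons_vertex (t : Fin 3 × Bool) (l : Fin 3) :
    triangulatedPentagons.vertex t l =
      doublePentagon.vertex (pentagonOf t) (pentagonHalfVertex (t, l)) := by
  have key : goldenLVertex t.1 (halfVertex (t, l)) + pentagonOffset t =
      bif pentagonOf t then shearedPentagon (pentagonHalfVertex (t, l))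
      else -shearedPentagon (pentagonHalfVertex (t, l)) := by
    simp only [goldenLVertex, pentagonOffset, shearedPentagon, goldenRatio_inv]
    generalize goldenRatio = g
    obtain ⟨i, b⟩ := t
    fin_cases i <;> cases b <;> fin_cases l <;> ext m <;> fin_cases m <;>
      simp [rectVertex, halfVertex, pentagonOf, pentagonHalfVertex] <;> ring
  change shearEquiv (goldenLVertex t.1 (halfVertex (t, l))) + shearEquiv (pentagonOffset t) = _
  rw [← map_add, key]
  cases h : pentagonOf t <;> simp [doublePentagon, pentagonVertex_eq_shear]

lemma isSubdivision_doublePentagon :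
    IsSubdivision triangulatedPentagons doublePentagon pentagonOf pentagonHalfVertex where
  vertex := triangulatedPentagons_vertex
  exists_outer := by decide
  outer_inj := by decide
  outer_glue := by
    change ∀ e, OuterSide _ (triangulationGlue e) ↔ _
    decide
  glue_outer := by
    change ∀ e, OuterSide _ e → (pentagonOf (triangulationGlue e).1,
      pentagonHalfVertex (triangulationGlue e)) = (!(pentagonOf e.1), _)
    decide
  cell_inner := by
    change ∀ e, ¬OuterSide _ e → pentagonOf (triangulationGlue e).1 = _
    decide
  glue_inner := by
    change ∀ e, ¬OuterSide _ e →
      pentagonHalfVertex ((triangulationGlue e).1, (triangulationGlue e).2 + 1) = _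
    decide
  inner_run := by
    have key : ∀ e k k', triangulationGlue e ≠ ((triangulationGlue e).1, k) →
        triangulationGlue ((triangulationGlue e).1, k) ≠
          ((triangulationGlue ((triangulationGlue e).1, k)).1, k') →
        OuterSide pentagonHalfVertex e ∨ OuterSide pentagonHalfVertex ((triangulationGlue e).1, k) ∨
        OuterSide pentagonHalfVertex
          ((triangulationGlue ((triangulationGlue e).1, k)).1, k') := by
      decide
    rintro e ⟨t, k⟩ ⟨t', k'⟩ rfl h1 rfl h2
    exact key e k k' h1 h2

/-- The trajectories on the golden L correspond to those on the double pentagon. -/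
theorem corr_goldenL_doublePentagon (v : Plane) :
    Corr goldenL v doublePentagon (shearEquiv v) shearEquiv :=
  ((isSubdivision_goldenL.corr (by norm_num) le_rfl v).trans
    ((isAffine_map triangulatedL shearEquiv cross_shearEquiv_pos
      fun t => shearEquiv (pentagonOffset t)).corr v)).trans
    (isSubdivision_doublePentagon.corr (by norm_num) le_rfl (shearEquiv v)).symm

/-! ### Symmetries -/

/-- The trajectories on the golden L in the directions `v` and `A v` correspond to each other. -/
def IsGoldenSymmetry (A : Plane ≃ₗ[ℝ] Plane) : Prop := ∀ v, Corr goldenL v goldenL (A v) A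

lemma IsGoldenSymmetry.trans {A B : Plane ≃ₗ[ℝ] Plane} (hA : IsGoldenSymmetry A)
    (hB : IsGoldenSymmetry B) : IsGoldenSymmetry (A.trans B) :=
  fun v => (hA v).trans (hB (A v))

lemma IsGoldenSymmetry.symm {A : Plane ≃ₗ[ℝ] Plane} (hA : IsGoldenSymmetry A) :
    IsGoldenSymmetry A.symm := fun v => by
  have := (hA (A.symm v)).symm
  rwa [A.apply_symm_apply] at this

lemma isAffine_of_point {ι ι' : Type} {n n' : ℕ} [NeZero n] [NeZero n']
    {S : TranslationSurface ι n} {S' : TranslationSurface ι' n'} {A : Plane ≃ₗ[ℝ] Plane}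
    {f : ι × Fin n ≃ ι' × Fin n'} {flip : Bool} (off : ι → Plane)
    (h₁ : ∀ e e', (f e).1 = (f e').1 ↔ e.1 = e'.1) (h₂ : ∀ e, f (S.glue e) = S'.glue (f e))
    (h₃ : ∀ e t, S'.point (f e) (bif flip then 1 - t else t) = A (S.point e t) + off e.1) :
    IsAffine S S' A f flip where
  polygon := h₁
  glue := h₂
  point e e' t t' he := by rw [h₃, h₃, he, map_sub]; abel

/-- Exchange of the coordinates. -/
def swapEquiv : Plane ≃ₗ[ℝ] Plane := linEquiv 0 1 1 0 (by norm_num)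

/-- Reflection in the vertical axis. -/
def mirrorEquiv : Plane ≃ₗ[ℝ] Plane := linEquiv (-1) 0 0 1 (by norm_num)

lemma isGoldenSymmetry_swap : IsGoldenSymmetry swapEquiv :=
  (isAffine_of_point (S := goldenL) (S' := goldenL) (flip := true)
    (f := ((Equiv.swap 1 2).prodCongr Fin.revPerm)) (fun _ => 0) (by decide)
    (by
      change ∀ e, ((Equiv.swap 1 2).prodCongr Fin.revPerm) (goldenLGlue e) =
        goldenLGlue (((Equiv.swap 1 2).prodCongr Fin.revPerm) e)
      decide)
    (by
      rintro ⟨i, k⟩ t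
      simp only [TranslationSurface.point, goldenL, goldenLVertex]
      generalize goldenRatio⁻¹ = g
      fin_cases i <;> fin_cases k <;> ext l <;> fin_cases l <;>
        simp [rectVertex, swapEquiv,
          linEquiv_apply, Equiv.swap_apply_def, Fin.rev] <;> ring)).corr

/-- Each piece is reflected in its own vertical axis: `x ↦ 1 - x` on the pieces `0` and `2`, `x ↦ 2
+ φ⁻¹ - x` on the piece `1`. The gluing is respected because the left and the right neighbour of a
piece coincide. -/
lemma isGoldenSymmetry_mirror : IsGoldenSymmetry mirrorEquiv :=
  (isAffine_of_point (S := goldenL) (S' := goldenL) (flip := true)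
    (f := ((Equiv.refl _).prodCongr (Equiv.swap 1 3)))
    (fun i => ![![1, 0], ![2 + goldenRatio⁻¹, 0], ![1, 0]] i) (by decide)
    (by
      change ∀ e, ((Equiv.refl _).prodCongr (Equiv.swap 1 3)) (goldenLGlue e) =
        goldenLGlue (((Equiv.refl _).prodCongr (Equiv.swap 1 3)) e)
      decide)
    (by
      rintro ⟨i, k⟩ t
      simp only [TranslationSurface.point, goldenL, goldenLVertex]
      generalize goldenRatio⁻¹ = g
      fin_cases i <;> fin_cases k <;> ext l <;> fin_cases l <;>
        simp [rectVertex, mirrorEquiv, linEquiv_apply, Equiv.swap_apply_def] <;> ring)).corr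

/-- The conjugate under `shear` of the rotation by `2π/5`. -/
def turnEquiv : Plane ≃ₗ[ℝ] Plane := linEquiv (-1) (-goldenRatio) goldenRatio goldenRatio
  (by have := Real.goldenRatio_sq; intro h; nlinarith)

lemma turnEquiv_shearedPentagon (k : Fin 5) :
    turnEquiv (shearedPentagon k) = shearedPentagon (k + 1) := by
  have hg := Real.goldenRatio_sq
  rw [turnEquiv, linEquiv_apply, shearedPentagon]
  generalize goldenRatio = g at *
  fin_cases k <;> ext l <;> fin_cases l <;> simp
  · linear_combination (-4 / 5 : ℝ) * hg
  · linear_combination (3 / 5 : ℝ) * hg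
  · linear_combination (1 / 5 : ℝ) * hg
  · linear_combination (-2 / 5 : ℝ) * hg
  · linear_combination (1 / 5 : ℝ) * hg
  · linear_combination (-2 / 5 : ℝ) * hg
  · linear_combination (1 / 5 : ℝ) * hg
  · linear_combination (3 / 5 : ℝ) * hg
  · linear_combination (1 / 5 : ℝ) * hg
  · linear_combination (-2 / 5 : ℝ) * hg

/-- The rotation by 2π/5 maps each of the two pentagons to itself and shifts the side indices by 1;
the correspondence with the double pentagon carries it over to the L. -/
lemma isGoldenSymmetry_turn : IsGoldenSymmetry turnEquiv := fun v => by
  have h : IsAffine doublePentagon doublePentagon ((shearEquiv.symm.trans turnEquiv).trans shearEquiv)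
      ((Equiv.refl _).prodCongr (Equiv.addRight 1)) false := by
    refine isAffine_of_point (fun _ => 0) (by decide) (fun e => rfl) ?_
    rintro ⟨b, k⟩ t
    cases b <;>
      simp [TranslationSurface.point, doublePentagon, pentagonVertex_eq_shear,
        turnEquiv_shearedPentagon]
  have h1 := ((corr_goldenL_doublePentagon v).trans (h.corr (shearEquiv v)))
  have h2 := (corr_goldenL_doublePentagon (turnEquiv v)).symm
  simp only [LinearEquiv.trans_apply, LinearEquiv.symm_apply_apply] at h1
  convert h1.trans h2 using 1
  ext w : 1
  simp


/-! ### Arithmetic of the vectors -/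

lemma int_add_mul_goldenRatio_inj {x y x' y' : ℤ}
    (h : (x : ℝ) + y * goldenRatio = x' + y' * goldenRatio) : x = x' ∧ y = y' := by
  have hy : y = y' := by
    by_contra hne
    refine (Real.goldenRatio_irrational.intCast_mul (sub_ne_zero.2 hne)).ne_int (x' - x) ?_
    push_cast
    linarith
  subst hy
  exact ⟨by exact_mod_cast add_right_cancel h, rfl⟩

lemma nat_add_mul_goldenRatio_inj {x y x' y' : ℕ}
    (h : (x : ℝ) + y * goldenRatio = x' + y' * goldenRatio) : x = x' ∧ y = y' := by
  have := int_add_mul_goldenRatio_inj (x := x) (y := y) (x' := x') (y' := y') (by exact_mod_cast h)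
  exact ⟨by exact_mod_cast this.1, by exact_mod_cast this.2⟩

lemma goldenVec_inj {a b c d a' b' c' d' : ℕ} (h : goldenVec a b c d = goldenVec a' b' c' d') :
    a = a' ∧ b = b' ∧ c = c' ∧ d = d' := by
  have h0 := nat_add_mul_goldenRatio_inj (congrFun h 0)
  have h1 := nat_add_mul_goldenRatio_inj (congrFun h 1)
  exact ⟨h0.1, h0.2, h1.1, h1.2⟩

lemma goldenVec_add (a b c d a' b' c' d' : ℕ) : goldenVec a b c d + goldenVec a' b' c' d' =
    goldenVec (a + a') (b + b') (c + c') (d + d') := by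
  ext l
  fin_cases l
  · change (a + b * goldenRatio : ℝ) + (a' + b' * goldenRatio) = (a + a' : ℕ) + (b + b' : ℕ) * _
    push_cast; ring
  · change (c + d * goldenRatio : ℝ) + (c' + d' * goldenRatio) = (c + c' : ℕ) + (d + d' : ℕ) * _
    push_cast; ring

lemma goldenRatio_smul_goldenVec (a b c d : ℕ) :
    goldenRatio • goldenVec a b c d = goldenVec b (a + b) d (c + d) := by
  have hg := Real.goldenRatio_sq
  ext l
  fin_cases l
  · change goldenRatio * (a + b * goldenRatio : ℝ) = b + (a + b : ℕ) * goldenRatio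
    push_cast; linear_combination (b : ℝ) * hg
  · change goldenRatio * (c + d * goldenRatio : ℝ) = d + (c + d : ℕ) * goldenRatio
    push_cast; linear_combination (d : ℝ) * hg

/-! ### The holonomy vectors of the golden L -/

lemma side_eq_of_cross_edge_pos {u : Plane} (hu : u ∈ positiveCone) {e : Fin 3 × Fin 4}
    (he : 0 < cross u (goldenL.edge e)) : e.2 = 1 ∨ e.2 = 2 ∧ 0 < u 1 := by
  obtain ⟨h0, h1⟩ := hu
  have hg := sub_pos.2 Real.one_lt_goldenRatio
  obtain ⟨i, k⟩ := e
  simp only [edge, goldenL, goldenLVertex, goldenRatio_inv] at he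
  generalize goldenRatio = g at *
  fin_cases i <;> fin_cases k <;> simp [rectVertex, cross] at he ⊢ <;> nlinarith

/-- Only right and top sides are crossed. Their translations vanish inside the L, and at its outer
boundary they are the widths φ and 1 or the heights 1 and φ. -/
lemma exists_disp_goldenL {u : Plane} (hu : u ∈ positiveCone) (e : Fin 3 × Fin 4)
    (he : 0 < cross u (goldenL.edge e)) : ∃ a b c d, goldenL.disp e = goldenVec a b c d := by
  have hinv := goldenRatio_inv
  have key : e.2 = 1 ∨ e.2 = 2 := (side_eq_of_cross_edge_pos hu he).imp_right And.left
  have hd : ∀ i : Fin 3, goldenL.disp (i, 1) = (![goldenVec 0 0 0 0, goldenVec 0 1 0 0,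
      goldenVec 1 0 0 0] : Fin 3 → Plane) i ∧ goldenL.disp (i, 2) = (![goldenVec 0 0 0 0,
      goldenVec 0 0 1 0, goldenVec 0 0 0 1] : Fin 3 → Plane) i := by
    intro i
    simp only [disp, goldenL, goldenLVertex, goldenLGlue, hinv, goldenVec]
    generalize goldenRatio = g at *
    fin_cases i <;> constructor <;> ext l <;> fin_cases l <;> simp [rectVertex, besides, above]
  obtain ⟨i, k⟩ := e
  rcases key with rfl | rfl
  · rw [(hd i).1]; fin_cases i <;> exact ⟨_, _, _, _, rfl⟩
  · rw [(hd i).2]; fin_cases i <;> exact ⟨_, _, _, _, rfl⟩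

lemma exists_goldenVec_of_hasHolonomy {u h : Plane} (hu : u ∈ positiveCone)
    {τ : goldenL.Trajectory u} (hh : τ.HasHolonomy h) : ∃ a b c d, h = goldenVec a b c d := by
  rw [Trajectory.hasHolonomy_iff] at hh
  obtain ⟨N, -, rfl⟩ := hh
  induction N with
  | zero => exact ⟨0, 0, 0, 0, by ext l; fin_cases l <;> simp [goldenVec]⟩
  | succ N ih =>
    obtain ⟨a, b, c, d, h⟩ := ih
    obtain ⟨a', b', c', d', h'⟩ := exists_disp_goldenL hu _ (τ.cross_edge_pos (by norm_num) N)
    exact ⟨_, _, _, _, by rw [Finset.sum_range_succ, h, h', goldenVec_add]⟩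

lemma ne_zero_of_mem_positiveCone {u : Plane} (hu : u ∈ positiveCone) : u ≠ 0 := by
  rintro rfl
  exact lt_irrefl _ hu.1

lemma smul_mem_positiveCone {u : Plane} (hu : u ∈ positiveCone) {t : ℝ} (ht : 0 < t) :
    t • u ∈ positiveCone :=
  ⟨mul_pos ht hu.1, mul_nonneg ht.le hu.2⟩

namespace TranslationSurface

variable {ι : Type} {n : ℕ} [NeZero n] {S : TranslationSurface ι n} {v : Plane}

lemma Trajectory.HasHolonomy.pos_of_smul {τ : S.Trajectory v} (hv : v ≠ 0) {t : ℝ}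
    (h : τ.HasHolonomy (t • v)) : 0 < t := by
  obtain ⟨t', h0, h'⟩ := h.isPeriodic.exists_holonomy
  rwa [smul_left_injective ℝ hv (h.unique h')]

/-- Changing the speed of the trajectories. -/
lemma corr_smul (S : TranslationSurface ι n) (v : Plane) {t : ℝ} (ht : 0 < t) :
    Corr S v S (t • v) (LinearEquiv.refl ℝ Plane) := by
  have key : ∀ (v : Plane) {t : ℝ} (ht : 0 < t) (v' : Plane) (hv : v' = t • v)
      (τ : S.Trajectory v), ∃ τ' : S.Trajectory v',
      ∀ k, τ'.side k = τ.side k ∧ τ'.pos k = τ.pos k := by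
    rintro v t ht _ rfl τ
    refine ⟨⟨τ.side, τ.pos, fun k => t⁻¹ * τ.time k, τ.pos_mem,
      fun k => mul_pos (inv_pos.2 ht) (τ.time_pos k), τ.same_polygon, τ.side_ne, fun k => ?_⟩,
      fun k => ⟨rfl, rfl⟩⟩
    rw [smul_smul, mul_right_comm, inv_mul_cancel₀ ht.ne', one_mul]
    exact τ.segment k
  refine ⟨fun τ τ' => ∀ k, τ'.side k = τ.side k ∧ τ'.pos k = τ.pos k, key v ht _ rfl,
    fun τ' => ?_, fun τ τ' σ σ' h h' => ?_, fun τ τ' w h => ?_⟩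
  · obtain ⟨τ, hτ⟩ := key (t • v) (inv_pos.2 ht) v
      (by rw [smul_smul, inv_mul_cancel₀ ht.ne', one_smul]) τ'
    exact ⟨τ, fun k => ⟨(hτ k).1.symm, (hτ k).2.symm⟩⟩
  · simp only [Trajectory.SameSides, (h _).1, (h' _).1]
  · simp only [Trajectory.hasHolonomy_iff, Trajectory.HasCombinatorialPeriod,
      Trajectory.ClosesAfter, (h _).1, (h _).2, LinearEquiv.refl_apply]

end TranslationSurface

/-- Each periodic direction in the positive cone is that of a short cylinder vector. -/
theorem exists_mem_Lambda {u : Plane} (hu : u ∈ positiveCone)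
    (hp : goldenL.IsPeriodicDirection u) : ∃ ℓ : ℝ, 0 < ℓ ∧
      ∃ a b c d : ℕ, goldenVec a b c d ∈ Lambda ∧ u = ℓ • goldenVec a b c d := by
  have hu0 := ne_zero_of_mem_positiveCone hu
  obtain ⟨τ₀, hτ₀⟩ := hp
  obtain ⟨t₀, ht₀, hh₀⟩ := hτ₀.exists_holonomy
  let H : Set ℝ := {t | t ≤ t₀ ∧ ∃ τ : goldenL.Trajectory u, τ.HasHolonomy (t • u)}
  -- The abscissa of a holonomy vector is `a + bφ` with `a, b ∈ ℕ`, so only finitely many values lie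
  -- below a bound.
  have hfin : H.Finite := by
    obtain ⟨K, hK⟩ := exists_nat_gt (t₀ * u 0)
    refine ((Finset.range K ×ˢ Finset.range K).finite_toSet.image
      fun p : ℕ × ℕ => (p.1 + p.2 * goldenRatio) / u 0).subset ?_
    rintro t ⟨ht, τ, hτ⟩
    obtain ⟨a, b, c, d, h⟩ := exists_goldenVec_of_hasHolonomy hu hτ
    have h0 : t * u 0 = a + b * goldenRatio := congrFun h 0
    have h1 : t * u 0 ≤ t₀ * u 0 := mul_le_mul_of_nonneg_right ht hu.1.le
    have hg := Real.one_lt_goldenRatio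
    have ha : (0 : ℝ) ≤ a := a.cast_nonneg
    have hb : (0 : ℝ) ≤ b := b.cast_nonneg
    refine ⟨(a, b), ?_, by simp only [← h0]; rw [mul_div_cancel_right₀ _ hu.1.ne']⟩
    simp only [Finset.coe_product, Finset.coe_range, Set.mem_prod, Set.mem_Iio]
    constructor <;> rw [← Nat.cast_lt (α := ℝ)] <;> nlinarith
  obtain ⟨t, ⟨ht, τ, hτ⟩, hmin⟩ := Set.exists_min_image H id hfin ⟨t₀, le_rfl, τ₀, hh₀⟩
  have hpos := hτ.pos_of_smul hu0
  obtain ⟨a, b, c, d, h⟩ := exists_goldenVec_of_hasHolonomy hu hτ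
  -- The direction is rescaled so that the shortest holonomy vector becomes the direction vector
  -- itself, as `Lambda` requires.
  obtain ⟨R, r1, r2, -, r4⟩ := corr_smul goldenL u hpos
  refine ⟨t⁻¹, inv_pos.2 hpos, a, b, c, d, ?_, by
    rw [← h, smul_smul, inv_mul_cancel₀ hpos.ne', one_smul]⟩
  rw [← h]
  refine ⟨⟨?_, fun σ s hs => ?_⟩, smul_mem_positiveCone hu hpos⟩
  · obtain ⟨τ', hτ'⟩ := r1 τ
    exact ⟨τ', (r4 _ _ _ hτ').1 hτ⟩
  · obtain ⟨σ', hσ'⟩ := r2 σ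
    have hs' := (r4 _ _ (s • t • u) hσ').2 hs
    rw [smul_smul] at hs'
    have : t ≤ s * t := by
      by_contra! hlt
      exact absurd (hmin (s * t) ⟨(hlt.trans_le ht).le, σ', hs'⟩) (not_le.2 hlt)
    nlinarith

/-! ### Renormalization -/

lemma turnEquiv_turnEquiv (v : Plane) :
    turnEquiv (turnEquiv v) = ![-goldenRatio * v 0 - v 1, v 0] := by
  have hg := Real.goldenRatio_sq
  rw [turnEquiv, linEquiv_apply, linEquiv_apply]
  generalize goldenRatio = g at *
  ext l
  fin_cases l <;> simp
  · linear_combination (-v 0 - v 1) * hg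
  · linear_combination v 0 * hg

lemma mirror_swap (v : Plane) : mirrorEquiv (swapEquiv v) = ![-v 1, v 0] := by
  ext l
  fin_cases l <;> simp [mirrorEquiv, swapEquiv, linEquiv_apply]

lemma isGoldenSymmetry_neg : ∃ A, IsGoldenSymmetry A ∧ ∀ v, A v = -v := by
  have h := isGoldenSymmetry_swap.trans isGoldenSymmetry_mirror
  refine ⟨_, h.trans h, fun v => ?_⟩
  simp only [LinearEquiv.trans_apply, mirror_swap]
  ext l
  fin_cases l <;> simp

/-- This map and the next three are, up to sign, powers of `turnEquiv` followed by the quarter turn.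
They send the cone `x > 0, y ≥ 0` onto the sectors of slopes [0, 1/φ), [1/φ, 1), [1, φ) and [φ, ∞).
-/
lemma exists_goldenSymmetry₀ :
    ∃ A, IsGoldenSymmetry A ∧ ∀ v, A v = ![v 0 + goldenRatio * v 1, v 1] := by
  have hg := Real.goldenRatio_sq
  have h2 := isGoldenSymmetry_turn.trans isGoldenSymmetry_turn
  refine ⟨_, (h2.trans isGoldenSymmetry_turn).trans
    (isGoldenSymmetry_swap.trans isGoldenSymmetry_mirror), fun v => ?_⟩
  simp only [LinearEquiv.trans_apply, mirror_swap, turnEquiv_turnEquiv]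
  rw [turnEquiv, linEquiv_apply]
  generalize goldenRatio = g at *
  ext l
  fin_cases l <;> simp
  linear_combination v 0 * hg

lemma exists_goldenSymmetry₁ : ∃ A, IsGoldenSymmetry A ∧ ∀ v,
    A v = ![goldenRatio * v 0 + goldenRatio * v 1, v 0 + goldenRatio * v 1] := by
  obtain ⟨B, hB, hB'⟩ := isGoldenSymmetry_neg
  refine ⟨_, (isGoldenSymmetry_turn.trans
    (isGoldenSymmetry_swap.trans isGoldenSymmetry_mirror)).trans hB, fun v => ?_⟩
  simp only [LinearEquiv.trans_apply, mirror_swap, hB']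
  rw [turnEquiv, linEquiv_apply]
  generalize goldenRatio = g
  ext l
  fin_cases l <;> simp
  ring

lemma exists_goldenSymmetry₂ : ∃ A, IsGoldenSymmetry A ∧ ∀ v,
    A v = ![goldenRatio * v 0 + v 1, goldenRatio * v 0 + goldenRatio * v 1] := by
  have hg := Real.goldenRatio_sq
  have h2 := isGoldenSymmetry_turn.trans isGoldenSymmetry_turn
  refine ⟨_, (h2.trans h2).trans (isGoldenSymmetry_swap.trans isGoldenSymmetry_mirror),
    fun v => ?_⟩
  simp only [LinearEquiv.trans_apply, mirror_swap, turnEquiv_turnEquiv]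
  generalize goldenRatio = g at *
  ext l
  fin_cases l <;> simp
  · ring
  · linear_combination v 0 * hg

lemma exists_goldenSymmetry₃ :
    ∃ A, IsGoldenSymmetry A ∧ ∀ v, A v = ![v 0, goldenRatio * v 0 + v 1] := by
  obtain ⟨B, hB, hB'⟩ := isGoldenSymmetry_neg
  have h2 := isGoldenSymmetry_turn.trans isGoldenSymmetry_turn
  refine ⟨_, (h2.trans (isGoldenSymmetry_swap.trans isGoldenSymmetry_mirror)).trans hB,
    fun v => ?_⟩
  simp only [LinearEquiv.trans_apply, mirror_swap, turnEquiv_turnEquiv, hB']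
  generalize goldenRatio = g
  ext l
  fin_cases l <;> simp
  ring

/-- The inverse symmetry takes short cylinder vectors to short cylinder vectors, so the preimage
again has natural coefficients and the descent can continue. -/
lemma IsGoldenSymmetry.exists_mem_Lambda {A : Plane ≃ₗ[ℝ] Plane} (hA : IsGoldenSymmetry A)
    {w : Plane} (hw : w ∈ positiveCone) (h : goldenL.IsShortCylinderVector (A w)) :
    ∃ a b c d, w = goldenVec a b c d ∧ goldenVec a b c d ∈ Lambda := by
  have h1 := (hA.symm (A w)).isShortCylinderVector h
  rw [A.symm_apply_apply] at h1
  obtain ⟨τ, hτ⟩ := h1.1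
  obtain ⟨a, b, c, d, e⟩ := exists_goldenVec_of_hasHolonomy hw hτ
  exact ⟨a, b, c, d, e, by rw [← e]; exact ⟨h1, hw⟩⟩

/-- In a horizontal direction, the golden L has two cylinders. -/
lemma hasTwoCylinders_horizontal {v : Plane} (h0 : 0 < v 0) (h1 : v 1 = 0) :
    goldenL.HasTwoCylinders v ![1, 0] ![goldenRatio, 0] := by
  have hg := sub_pos.2 Real.one_lt_goldenRatio
  have hinv := goldenRatio_inv
  have hb : ∀ i, besides (besides i) = i := by decide
  have hdisp : ∀ i : Fin 3, goldenL.disp (i, 1) =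
      (![0, ![goldenRatio, 0], ![1, 0]] : Fin 3 → Plane) i := by
    intro i
    simp only [disp, goldenL, goldenLVertex, goldenLGlue, hinv]
    generalize goldenRatio = g at *
    fin_cases i <;> ext l <;> fin_cases l <;> simp [rectVertex, besides]
  have hcross : ∀ i : Fin 3, cross v (goldenL.disp (i, 1)) = 0 := by
    intro i
    rw [hdisp]
    fin_cases i <;> simp [cross, h1]
  have ex : ∀ i : Fin 3, ∃ τ : goldenL.Trajectory v,
      ∀ k, τ.side k = (if Even k then i else besides i, 1) := by
    intro i
    obtain ⟨c, hc⟩ : ∃ c, ∀ j, (j = i ∨ j = besides i) → goldenL.Ascends v c j 1 := by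
      -- The line at half the height φ - 1 of the upper rectangle, measured from the bottom of the
      -- piece `i`, lies inside both pieces of the cycle.
      refine ⟨v 0 * ((![0, 0, 1] : Fin 3 → ℝ) i + (goldenRatio - 1) / 2), ?_⟩
      have hg' := Real.goldenRatio_lt_two
      simp only [Ascends, goldenL, goldenLVertex, hinv]
      generalize goldenRatio = g at *
      intro j hj
      fin_cases i <;> fin_cases j <;> simp [besides] at hj <;>
        simp [rectVertex, cross, h1] <;> constructor <;> nlinarith
    obtain ⟨τ, hτ, -⟩ := Trajectory.exists_of_levels (S := goldenL) (v := v) (by norm_num)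
      (fun k : ℤ => (if Even k then i else besides i, (1 : Fin 4))) (fun _ => c)
      (fun k => hc _ (by split_ifs <;> simp))
      (fun k => by
        by_cases hk : Even k
        · simp [hk, goldenL, goldenLGlue]
        · simp only [Int.even_add_one, hk, if_false, not_false_eq_true, if_true]
          exact hb i)
      (fun k => by simp [hcross])
    exact ⟨τ, hτ⟩
  obtain ⟨τ₁, hτ₁⟩ := ex 2
  obtain ⟨τ₂, hτ₂⟩ := ex 0
  refine ⟨τ₁, τ₂, ?_, ?_, fun τ hτ => ?_⟩
  · rw [Trajectory.hasHolonomy_iff]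
    refine ⟨1, ⟨(Trajectory.closesAfter_iff_side (by norm_num) _ _).2 ⟨one_pos, fun k => ?_⟩,
      fun M hM => hM.1⟩, ?_⟩
    · rw [hτ₁, hτ₁]
      simp [besides]
    · simp [hτ₁, hdisp]
  · rw [Trajectory.hasHolonomy_iff]
    refine ⟨2, ⟨(Trajectory.closesAfter_iff_side (by norm_num) _ _).2 ⟨two_pos, fun k => ?_⟩,
      fun M hM => ?_⟩, ?_⟩
    · rw [hτ₂, hτ₂]
      simp
    · by_contra! hlt
      obtain rfl : M = 1 := by have := hM.1; omega
      have := (hM.2 0).1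
      rw [hτ₂, hτ₂] at this
      simp [besides] at this
    · have : ¬Even (1 : ℤ) := by decide
      simp only [Finset.sum_range_succ, Finset.sum_range_zero, hτ₂, hdisp]
      simp [this, besides]
  · have hs : ∀ k, (τ.side k).2 = 1 := by
      intro k
      have he := side_eq_of_cross_edge_pos ⟨h0, h1.ge⟩ (τ.cross_edge_pos (by norm_num) k)
      simpa [h1] using he
    have hp : ∀ k, besides (τ.side k).1 = (τ.side (k + 1)).1 := by
      intro k
      have := τ.same_polygon k
      rw [show τ.side k = ((τ.side k).1, 1) from Prod.ext rfl (hs k)] at this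
      exact this
    have hall : ∀ k, (τ.side k).1 = if Even k then (τ.side 0).1 else besides (τ.side 0).1 := by
      intro k
      induction k using Int.induction_on with
      | zero => simp
      | succ i ih =>
        rw [← hp, ih]
        by_cases hk : Even (i : ℤ)
        · rw [if_pos hk, if_neg (by rw [Int.even_add_one]; exact not_not.2 hk)]
        · rw [if_neg hk, if_pos (by rw [Int.even_add_one]; exact hk), hb]
      | pred i ih =>
        have h2 := hp (-i - 1)
        rw [sub_add_cancel, ih] at h2
        rw [← hb (τ.side (-i - 1)).1, h2]
        by_cases hk : Even (-(i : ℤ))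
        · rw [if_pos hk, if_neg (by rw [Int.even_sub_one]; exact not_not.2 hk)]
        · rw [if_neg hk, if_pos (by rw [Int.even_sub_one]; exact hk), hb]
    -- The upper rectangle is its own neighbour, while the square and the right rectangle alternate;
    -- a start in the latter is a shift by one crossing.
    have hi : ∀ i : Fin 3, i = 2 ∨ i = 0 ∨ i = 1 := by decide
    rcases hi (τ.side 0).1 with h | h | h
    · refine Or.inl ⟨0, fun k => ?_⟩
      rw [hτ₁, add_zero]
      exact Prod.ext (by rw [hall, h]) (hs k).symm
    · refine Or.inr ⟨0, fun k => ?_⟩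
      rw [hτ₂, add_zero]
      exact Prod.ext (by rw [hall, h]) (hs k).symm
    · refine Or.inr ⟨1, fun k => ?_⟩
      rw [hτ₂]
      refine Prod.ext ?_ (hs _).symm
      rw [hall, h]
      by_cases hk : Even k <;> simp [hk, besides]

/-- A short cylinder vector in the positive cone is the holonomy vector of one of two cylinders. -/
theorem hasTwoCylinders_goldenL {v : Plane} (hv : v ∈ Lambda) :
    goldenL.HasTwoCylinders v v (goldenRatio • v) := by
  have hg := Real.goldenRatio_sq
  have hg1 := Real.one_lt_goldenRatio
  suffices H : ∀ (N a b c d : ℕ), a + b + c + d = N → goldenVec a b c d ∈ Lambda →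
      goldenL.HasTwoCylinders (goldenVec a b c d) (goldenVec a b c d)
        (goldenRatio • goldenVec a b c d) by
    obtain ⟨τ, hτ⟩ := hv.1.1
    obtain ⟨a, b, c, d, rfl⟩ := exists_goldenVec_of_hasHolonomy hv.2 hτ
    exact H _ a b c d rfl hv
  intro N
  induction N using Nat.strong_induction_on with
  | _ N ih =>
    intro a b c d hN hv
    -- the induction step from a preimage under a symmetry
    have step : ∀ A, IsGoldenSymmetry A → ∀ w ∈ positiveCone, A w = goldenVec a b c d →
        (∀ a' b' c' d', w = goldenVec a' b' c' d' → a' + b' + c' + d' < N) →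
        goldenL.HasTwoCylinders (goldenVec a b c d) (goldenVec a b c d)
          (goldenRatio • goldenVec a b c d) := by
      intro A hA w hw hAw hlt
      rw [← hAw] at hv ⊢
      obtain ⟨a', b', c', d', rfl, hw'⟩ := hA.exists_mem_Lambda hw hv.1
      have := (hA _).hasTwoCylinders (ih _ (hlt a' b' c' d' rfl) a' b' c' d' rfl hw')
      rwa [map_smul] at this
    have hx : 0 < goldenVec a b c d 0 := hv.2.1
    have hy : 0 ≤ goldenVec a b c d 1 := hv.2.2
    have key : ∀ a' b' c' d', 0 < goldenVec a' b' c' d' 0 → 0 < a' + b' := by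
      intro a' b' c' d' h
      by_contra! h0
      obtain ⟨rfl, rfl⟩ : a' = 0 ∧ b' = 0 := by omega
      simp [goldenVec] at h
    have key' : ∀ a' b' c' d', 0 < goldenVec a' b' c' d' 1 → 0 < c' + d' := by
      intro a' b' c' d' h
      by_contra! h0
      obtain ⟨rfl, rfl⟩ : c' = 0 ∧ d' = 0 := by omega
      simp [goldenVec] at h
    rcases hy.eq_or_lt with hy | hy
    · have h2 := hasTwoCylinders_horizontal hx hy.symm
      -- The other candidate `[φ, 0]` is not short: a trajectory of the first cylinder has φ⁻¹ times
      -- its length.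
      have hv1 : goldenVec a b c d = ![1, 0] := by
        obtain ⟨τ₁, τ₂, a1, a2, a3⟩ := h2
        obtain ⟨⟨τ, hτ⟩, hmin⟩ := hv.1
        rcases a3 τ hτ.isPeriodic with h | h
        · exact hτ.unique (h.hasHolonomy (by norm_num) a1)
        · have e := hτ.unique (h.hasHolonomy (by norm_num) a2)
          exfalso
          have h3 : (![1, 0] : Plane) = goldenRatio⁻¹ • goldenVec a b c d := by
            rw [e]
            ext l
            fin_cases l
            · exact (inv_mul_cancel₀ Real.goldenRatio_pos.ne').symm
            · simp
          rw [h3] at a1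
          have := hmin τ₁ _ a1
          exact absurd this (not_le.2 (inv_lt_one_of_one_lt₀ hg1))
      have e2 : goldenRatio • goldenVec a b c d = ![goldenRatio, 0] := by
        rw [hv1]
        ext l
        fin_cases l
        · exact mul_one _
        · exact mul_zero _
      rw [e2]
      nth_rewrite 2 [hv1]
      exact h2
    have eta : ∀ w : Plane, w = ![w 0, w 1] := fun w => by ext l; fin_cases l <;> rfl
    have eq_of : ∀ {x y : ℝ}, x = goldenVec a b c d 0 → y = goldenVec a b c d 1 →
        ![x, y] = goldenVec a b c d := by
      rintro x y rfl rfl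
      exact (eta _).symm
    have coords : ∀ a' b' c' d', goldenVec a' b' c' d' 0 = a' + b' * goldenRatio ∧
        goldenVec a' b' c' d' 1 = c' + d' * goldenRatio := fun _ _ _ _ => ⟨rfl, rfl⟩
    have hkx := key _ _ _ _ hx
    have hky := key' _ _ _ _ hy
    set x := goldenVec a b c d 0 with hxd
    set y := goldenVec a b c d 1 with hyd
    -- The slope selects the sector, and the inverse of its map gives the preimage in the cone. By
    -- irrationality of φ the coefficients of the image are definite sums of those of the preimage,
    -- with a larger total: here it grows by `c' + 2d'`, which is positive because `y > 0`.
    rcases lt_or_ge (goldenRatio * y) x with h | h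
    · obtain ⟨A, hA, hA'⟩ := exists_goldenSymmetry₀
      have hAw : A ![x - goldenRatio * y, y] = goldenVec a b c d := by
        rw [hA']
        refine eq_of ?_ ?_
        · change x - goldenRatio * y + goldenRatio * y = _; ring
        · rfl
      refine step A hA ![x - goldenRatio * y, y] ⟨sub_pos.2 h, hy.le⟩ hAw fun a' b' c' d' e => ?_
      rw [e, hA', (coords a' b' c' d').1, (coords a' b' c' d').2] at hAw
      have : goldenVec (a' + d') (b' + c' + d') c' d' = goldenVec a b c d := by
        rw [← hAw]
        ext l
        fin_cases l
        · change ((a' + d' : ℕ) : ℝ) + (b' + c' + d' : ℕ) * goldenRatio =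
            a' + b' * goldenRatio + goldenRatio * (c' + d' * goldenRatio)
          push_cast
          linear_combination -(d' : ℝ) * hg
        · rfl
      obtain ⟨rfl, rfl, rfl, rfl⟩ := goldenVec_inj this
      omega
    rcases lt_or_ge y x with h' | h'
    · obtain ⟨A, hA, hA'⟩ := exists_goldenSymmetry₁
      have hAw : A ![goldenRatio * (x - y), goldenRatio * y - x] = goldenVec a b c d := by
        rw [hA']
        refine eq_of ?_ ?_
        · change goldenRatio * (goldenRatio * (x - y)) + goldenRatio * (goldenRatio * y - x) = x
          linear_combination x * hg
        · change goldenRatio * (x - y) + goldenRatio * (goldenRatio * y - x) = y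
          linear_combination y * hg
      have hw : (![goldenRatio * (x - y), goldenRatio * y - x] : Plane) ∈ positiveCone :=
        ⟨mul_pos (by linarith) (sub_pos.2 h'), sub_nonneg.2 h⟩
      refine step A hA _ hw hAw fun a' b' c' d' e => ?_
      have h0 := key a' b' c' d' (by rw [← e]; exact hw.1)
      rw [e, hA', (coords a' b' c' d').1, (coords a' b' c' d').2] at hAw
      have : goldenVec (b' + d') (a' + b' + c' + d') (a' + d') (b' + c' + d') =
          goldenVec a b c d := by
        rw [← hAw]
        ext l
        fin_cases l
        · change ((b' + d' : ℕ) : ℝ) + (a' + b' + c' + d' : ℕ) * goldenRatio =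
            goldenRatio * (a' + b' * goldenRatio) + goldenRatio * (c' + d' * goldenRatio)
          push_cast
          linear_combination (-(b' : ℝ) - d') * hg
        · change ((a' + d' : ℕ) : ℝ) + (b' + c' + d' : ℕ) * goldenRatio =
            a' + b' * goldenRatio + goldenRatio * (c' + d' * goldenRatio)
          push_cast
          linear_combination -(d' : ℝ) * hg
      obtain ⟨rfl, rfl, rfl, rfl⟩ := goldenVec_inj this
      omega
    rcases lt_or_ge y (goldenRatio * x) with h'' | h''
    · obtain ⟨A, hA, hA'⟩ := exists_goldenSymmetry₂
      have hAw : A ![goldenRatio * x - y, goldenRatio * (y - x)] = goldenVec a b c d := by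
        rw [hA']
        refine eq_of ?_ ?_
        · change goldenRatio * (goldenRatio * x - y) + goldenRatio * (y - x) = x
          linear_combination x * hg
        · change goldenRatio * (goldenRatio * x - y) + goldenRatio * (goldenRatio * (y - x)) = y
          linear_combination y * hg
      have hw : (![goldenRatio * x - y, goldenRatio * (y - x)] : Plane) ∈ positiveCone :=
        ⟨sub_pos.2 h'', mul_nonneg (by linarith) (sub_nonneg.2 h')⟩
      refine step A hA _ hw hAw fun a' b' c' d' e => ?_
      have h0 := key a' b' c' d' (by rw [← e]; exact hw.1)
      rw [e, hA', (coords a' b' c' d').1, (coords a' b' c' d').2] at hAw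
      have : goldenVec (b' + c') (a' + b' + d') (b' + d') (a' + b' + c' + d') =
          goldenVec a b c d := by
        rw [← hAw]
        ext l
        fin_cases l
        · change ((b' + c' : ℕ) : ℝ) + (a' + b' + d' : ℕ) * goldenRatio =
            goldenRatio * (a' + b' * goldenRatio) + (c' + d' * goldenRatio)
          push_cast
          linear_combination -(b' : ℝ) * hg
        · change ((b' + d' : ℕ) : ℝ) + (a' + b' + c' + d' : ℕ) * goldenRatio =
            goldenRatio * (a' + b' * goldenRatio) + goldenRatio * (c' + d' * goldenRatio)
          push_cast
          linear_combination (-(b' : ℝ) - d') * hg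
      obtain ⟨rfl, rfl, rfl, rfl⟩ := goldenVec_inj this
      omega
    · obtain ⟨A, hA, hA'⟩ := exists_goldenSymmetry₃
      have hAw : A ![x, y - goldenRatio * x] = goldenVec a b c d := by
        rw [hA']
        refine eq_of ?_ ?_
        · rfl
        · change goldenRatio * x + (y - goldenRatio * x) = _; ring
      refine step A hA ![x, y - goldenRatio * x] ⟨hx, sub_nonneg.2 h''⟩ hAw fun a' b' c' d' e => ?_
      have h0 := key a' b' c' d' (by rw [← e]; exact hx)
      rw [e, hA', (coords a' b' c' d').1, (coords a' b' c' d').2] at hAw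
      have : goldenVec a' b' (c' + b') (d' + a' + b') = goldenVec a b c d := by
        rw [← hAw]
        ext l
        fin_cases l
        · rfl
        · change ((c' + b' : ℕ) : ℝ) + (d' + a' + b' : ℕ) * goldenRatio =
            goldenRatio * (a' + b' * goldenRatio) + (c' + d' * goldenRatio)
          push_cast
          linear_combination -(b' : ℝ) * hg
      obtain ⟨rfl, rfl, rfl, rfl⟩ := goldenVec_inj this
      omega


/-! ### Counting crossings on the double pentagon -/

/-- The trajectories in the directions of the theorem leave the upright pentagon through its sides
`3` and `4`, and the other pentagon through its sides `0`, `1` and `2`. -/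
lemma pentagon_eq_of_cross_edge_pos {u : Plane} (hu : u ∈ positiveCone) {e : Bool × Fin 5}
    (he : 0 < cross (shearEquiv u) (doublePentagon.edge e)) : e.1 = decide (3 ≤ e.2) := by
  obtain ⟨h0, h1⟩ := hu
  have hg := sub_pos.2 Real.one_lt_goldenRatio
  have key : doublePentagon.edge e = shearEquiv (bif e.1 then
      shearedPentagon (e.2 + 1) - shearedPentagon e.2
      else shearedPentagon e.2 - shearedPentagon (e.2 + 1)) := by
    obtain ⟨b, k⟩ := e
    cases b <;> simp only [edge, doublePentagon, pentagonVertex_eq_shear, cond_true, cond_false,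
      map_sub]
    abel
  rw [key, cross_shearEquiv] at he
  replace he := pos_of_mul_pos_right he sin_pi_div_five_pos.le
  obtain ⟨b, k⟩ := e
  simp only [shearedPentagon] at he
  generalize goldenRatio = g at *
  cases b <;> fin_cases k <;> simp [cross] at he ⊢ <;> nlinarith

/-- The total translation of a trajectory that crosses the side `k` of the pentagons `n k` times,
reduced by the same vector for each crossing. -/
def crossingSum (n : Fin 5 → ℤ) : Plane :=
  ![(n 0 + n 1 - n 4) * goldenRatio + n 0, (n 4 - n 0) * goldenRatio + (n 3 + n 4 - n 0 - n 1)]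

lemma crossingSum_add (n n' : Fin 5 → ℤ) :
    crossingSum (n + n') = crossingSum n + crossingSum n' := by
  ext l
  fin_cases l <;> simp [crossingSum] <;> ring

/-- The translation at a side is, before the shear, ± the sum of the two ends of the side. It
differs from the `crossingSum` of that single crossing by a fixed vector, with opposite signs for
the two pentagons, so the fixed vector cancels in a pair. -/
lemma disp_add_disp {e e' : Bool × Fin 5} (he : e.1 = decide (3 ≤ e.2))
    (he' : e'.1 = decide (3 ≤ e'.2)) (h : e'.1 = !e.1) : ∃ n : Fin 5 → ℤ, n 3 + n 4 = 1 ∧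
      doublePentagon.disp e + doublePentagon.disp e' = shearEquiv (crossingSum n) := by
  have key : ∀ k k' : Fin 5, 3 ≤ k → k' < 3 → ∃ n : Fin 5 → ℤ, n 3 + n 4 = 1 ∧
      doublePentagon.disp (true, k) + doublePentagon.disp (false, k') =
        shearEquiv (crossingSum n) := by
    intro k k' hk hk'
    have e1 : doublePentagon.disp (true, k) + doublePentagon.disp (false, k') =
        shearEquiv (shearedPentagon k + shearedPentagon (k + 1) -
          (shearedPentagon k' + shearedPentagon (k' + 1))) := by
      simp only [disp, doublePentagon, pentagonVertex_eq_shear, cond_true, cond_false, map_sub,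
        map_add, Bool.not_true, Bool.not_false]
      abel
    refine ⟨Pi.single k 1 + Pi.single k' 1, ?_, ?_⟩
    · clear e1
      revert k k'
      simp only [Pi.add_apply, Pi.single_apply]
      decide
    · rw [e1]
      congr 1
      simp only [shearedPentagon, crossingSum]
      generalize goldenRatio = g
      fin_cases k <;> simp at hk <;> fin_cases k' <;> simp at hk' <;> ext l <;> fin_cases l <;>
        simp <;> ring
  obtain ⟨b, k⟩ := e
  obtain ⟨b', k'⟩ := e'
  simp only at he he' h
  cases b
  · obtain rfl : b' = true := h
    rw [add_comm]
    exact key k' k (by simpa using he'.symm) (by simpa using he.symm)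
  · obtain rfl : b' = false := h
    exact key k k' (by simpa using he.symm) (by simpa using he'.symm)

section Period

variable {u : Plane} {τ : doublePentagon.Trajectory (shearEquiv u)}

lemma pentagon_eq (hu : u ∈ positiveCone) (τ : doublePentagon.Trajectory (shearEquiv u)) (k : ℤ) :
    (τ.side k).1 = decide (3 ≤ (τ.side k).2) :=
  pentagon_eq_of_cross_edge_pos hu (τ.cross_edge_pos (by norm_num) k)

lemma pentagon_succ (τ : doublePentagon.Trajectory (shearEquiv u)) (k : ℤ) :
    (τ.side (k + 1)).1 = !(τ.side k).1 := (τ.same_polygon k).symm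

/-- The crossings are grouped in consecutive pairs. Each pair leaves each pentagon once and so adds
1 to `n 3 + n 4`. -/
lemma exists_crossingSum (hu : u ∈ positiveCone)
    (τ : doublePentagon.Trajectory (shearEquiv u)) (M : ℕ) : ∃ n : Fin 5 → ℤ, n 3 + n 4 = M ∧
    ∑ k ∈ Finset.range (2 * M), doublePentagon.disp (τ.side k) = shearEquiv (crossingSum n) := by
  induction M with
  | zero =>
    refine ⟨0, rfl, ?_⟩
    have : crossingSum 0 = 0 := by ext l; fin_cases l <;> simp [crossingSum]
    simp [this]
  | succ M ih =>
    obtain ⟨n, h1, h2⟩ := ih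
    obtain ⟨n', h1', h2'⟩ := disp_add_disp (pentagon_eq hu τ (2 * M : ℕ))
      (pentagon_eq hu τ ((2 * M : ℕ) + 1)) (pentagon_succ τ _)
    refine ⟨n + n', ?_, ?_⟩
    · simp only [Pi.add_apply]
      push_cast
      linarith
    · rw [show 2 * (M + 1) = 2 * M + 1 + 1 by ring, Finset.sum_range_succ, Finset.sum_range_succ,
        h2, add_assoc, Nat.cast_succ, h2', ← map_add, crossingSum_add]

lemma even_of_closesAfter {N : ℕ} (hN : τ.ClosesAfter N) : Even N := by
  have key : ∀ m : ℕ, (τ.side m).1 = (τ.side 0).1 ↔ Even m := by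
    intro m
    induction m with
    | zero => simp
    | succ m ih =>
      push_cast
      rw [pentagon_succ, Nat.even_add_one, ← ih]
      cases (τ.side m).1 <;> cases (τ.side 0).1 <;> simp
  have := (hN.2 0).1
  rw [zero_add] at this
  rw [← key, this]

/-- The holonomy vector determines the combinatorial period. -/
lemma hasCombinatorialPeriod_of_hasHolonomy (hu : u ∈ positiveCone) {a b c d : ℕ}
    (h : τ.HasHolonomy (shearEquiv (goldenVec a b c d))) :
    τ.HasCombinatorialPeriod (2 * (a + b + c + d)) := by
  rw [Trajectory.hasHolonomy_iff] at h
  obtain ⟨N, hN, h⟩ := h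
  obtain ⟨M, rfl⟩ := (even_of_closesAfter hN.1).exists_two_nsmul
  rw [smul_eq_mul] at h hN
  obtain ⟨n, h1, h2⟩ := exists_crossingSum hu τ M
  rw [h2] at h
  have h3 := shearEquiv.injective h
  have e0 : (a : ℝ) + b * goldenRatio = (n 0 + n 1 - n 4) * goldenRatio + n 0 := congrFun h3 0
  have e1 : (c : ℝ) + d * goldenRatio =
    (n 4 - n 0) * goldenRatio + (n 3 + n 4 - n 0 - n 1) := congrFun h3 1
  -- Irrationality of φ separates the four coefficients; the sum of the four equations is a + b + c
  -- + d = n₃ + n₄ = M.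
  obtain ⟨r1, r2⟩ := int_add_mul_goldenRatio_inj (x := a) (y := b) (x' := n 0)
    (y' := n 0 + n 1 - n 4) (by push_cast; linarith)
  obtain ⟨r3, r4⟩ := int_add_mul_goldenRatio_inj (x := c) (y := d) (x' := n 3 + n 4 - n 0 - n 1)
    (y' := n 4 - n 0) (by push_cast; linarith)
  obtain rfl : M = a + b + c + d := by omega
  exact hN

/-- The edge that is crossed determines the side. -/
lemma hasCuttingPeriod_of_hasCombinatorialPeriod (hu : u ∈ positiveCone) {N : ℕ}
    (h : τ.HasCombinatorialPeriod N) :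
    τ.HasCuttingPeriod N := by
  refine ⟨⟨h.1.1, fun k => ?_⟩, fun M hM => h.2 ?_⟩
  · rw [Trajectory.cuttingSequence, (h.1.2 k).1, Trajectory.cuttingSequence]
  · refine (Trajectory.closesAfter_iff_side (by norm_num) τ M).2 ⟨hM.1, fun k => ?_⟩
    have h1 := hM.2 k
    rw [Trajectory.cuttingSequence, Trajectory.cuttingSequence, Sym2.eq_iff] at h1
    -- Glued sides have the same index, and the index determines which of the two pentagons is left.
    have h2 : (τ.side (k + M)).2 = (τ.side k).2 := by
      rcases h1 with h1 | h1
      · rw [h1.1]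
      · rw [h1.1]; rfl
    exact Prod.ext (by rw [pentagon_eq hu, pentagon_eq hu, h2]) h2

end Period

end PentagonL
end

/-! ### The Combinatorial Period Theorem -/

open PentagonL
theorem mainTheorem3 :
    (∀ u ∈ positiveCone, goldenL.IsPeriodicDirection u →
      ∃ ℓ : ℝ, 0 < ℓ ∧ ∃ a b c d : ℕ, goldenVec a b c d ∈ Lambda ∧ u = ℓ • goldenVec a b c d) ∧
    ∀ a b c d : ℕ, goldenVec a b c d ∈ Lambda →
      (∃ short long : Set (goldenL.Trajectory (goldenVec a b c d)),
        short ≠ long ∧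
        {C | goldenL.IsCylinder (goldenVec a b c d) C} = {short, long} ∧
        (∀ τ ∈ short, τ.HasHolonomy (goldenVec a b c d)) ∧
        (∀ τ ∈ long, τ.HasHolonomy (Real.goldenRatio • goldenVec a b c d))) ∧
      (∃ short long : Set (doublePentagon.Trajectory (shear (goldenVec a b c d))),
        short ≠ long ∧
        {C | doublePentagon.IsCylinder (shear (goldenVec a b c d)) C} = {short, long} ∧
        (∀ τ ∈ short, τ.HasHolonomy (shear (goldenVec a b c d)) ∧
          τ.HasCombinatorialPeriod (2 * (a + b + c + d)) ∧
          τ.HasCuttingPeriod (2 * (a + b + c + d))) ∧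
        (∀ τ ∈ long, τ.HasHolonomy (Real.goldenRatio • shear (goldenVec a b c d)) ∧
          τ.HasCombinatorialPeriod (2 * (a + 2 * b + c + 2 * d)) ∧
          τ.HasCuttingPeriod (2 * (a + 2 * b + c + 2 * d)))) := by
  refine ⟨fun u hu hp => exists_mem_Lambda hu hp, fun a b c d hv => ?_⟩
  have h2 := hasTwoCylinders_goldenL hv
  have hne : ∀ w : Plane, w ≠ 0 → w ≠ Real.goldenRatio • w := by
    intro w hw h
    refine Real.one_lt_goldenRatio.ne (smul_left_injective ℝ hw ?_)
    simpa using h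
  have hv0 := ne_zero_of_mem_positiveCone hv.2
  have hw0 : shear (goldenVec a b c d) ≠ 0 := by
    rw [← shearEquiv_apply]
    simpa using hv0
  refine ⟨h2.isCylinder (by norm_num) (hne _ hv0), ?_⟩
  have h3 := (corr_goldenL_doublePentagon _).hasTwoCylinders h2
  rw [map_smul] at h3
  rw [← shearEquiv_apply] at hw0 ⊢
  obtain ⟨short, long, e1, e2, e3, e4⟩ := h3.isCylinder (by norm_num) (hne _ hw0)
  refine ⟨short, long, e1, e2, fun τ hτ => ?_, fun τ hτ => ?_⟩
  · have hp := hasCombinatorialPeriod_of_hasHolonomy hv.2 (e3 τ hτ)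
    exact ⟨e3 τ hτ, hp, hasCuttingPeriod_of_hasCombinatorialPeriod hv.2 hp⟩
  · have hh := e4 τ hτ
    rw [← map_smul, goldenRatio_smul_goldenVec] at hh
    have hp := hasCombinatorialPeriod_of_hasHolonomy hv.2 hh
    rw [show 2 * (b + (a + b) + d + (c + d)) = 2 * (a + 2 * b + c + 2 * d) by ring] at hp
    exact ⟨e4 τ hτ, hp, hasCuttingPeriod_of_hasCombinatorialPeriod hv.2 hp⟩
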